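/- **Setting.** Let $\mathbb S^1=\mathbb R/\mathbb Z$ and let $f:\mathbb S^1\times\mathbb R\to\mathbb R$ be a smooth ($C^\infty$) function; $D_2^jf$ is its $j$-th partial derivative in the second variable. Let $F:B^1\to B^0$, $F(u)(t)=u'(t)+f(t,u(t))$, where either $B^1=C^1(\mathbb S^1)$ and $B^0=C^0(\mathbb S^1)$, or $B^1=H^1(\mathbb S^1)$ and $B^0=L^2(\mathbb S^1)$. The result holds in both cases. *Strata.* For a function $g$ on $\mathbb S^1$ write $\bar g=\int_{\mathbb S^1} g$ and $\tilde g=g-\bar g$. The map $\Psi:B^1\to B^0$, $\Psi(u)=\widetilde{F(u)}+\bar u$, is a diffeomorphism onto an open subset of $B^0$, and $F\circ\Psi^{-1}$ has the form $\tilde v+\bar u\mapsto\tilde v+\phi(\tilde v,\bar u)$ with $\phi$ real valued. For $k\ge1$ let $S_k$ be the set of $u\in B^1$ such that $D_2\phi=\dots=D_2^k\phi=0$ at the point $\Psi(u)$. *Morin singularities.* Let $G:Z_1\to Z_2$ be a smooth map between Banach spaces. A point $z_0$ is a Morin singularity of order $k\ge 1$ of $G$ if $DG(z_0)$ is a Fredholm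 operator of index $0$ with kernel of dimension $1$ and, after smooth changes of variables near $z_0$ and $G(z_0)$, the map $G$ is written as $X\times\mathbb R\to X\times\mathbb R$, $(x,y)\mapsto(x,\mu(x,y))$, with $X$ a Banach space, so that at the point corresponding to $z_0$: $D_2\mu=\dots=D_2^k\mu=0$, $D_2^{k+1}\mu\neq0$, and the derivative of $(D_2\mu,\dots,D_2^{k-1}\mu)$ is surjective onto $\mathbb R^{k-1}$. *Functionals.* For $u\in B^1$ let $\kappa(x)=x-\lfloor x\rfloor-\frac12$ and $w(t)=w_u(t)=\exp\left(-\int_0^1\kappa(s-t)\,D_2f(s,u(s))\,ds\right)$, and put $A(t)=\int_0^tD_2^2f(s,u(s))\,w(s)\,ds$. Define $$\begin{aligned} \Sigma_1(u)&=\int_0^1D_2f(t,u(t))\,dt,\\ \Sigma_2(u)&=\int_0^1D_2^2f(t,u(t))\,w(t)\,dt,\\ \Sigma_3(u)&=\int_0^1D_2^3f(t,u(t))\,w(t)^2\,dt,\\ \Sigma_4(u)&=\int_0^1\Big(D_2^4f(t,u(t))\,w(t)^3-2D_2^3f(t,u(t))\,w(t)^2A(t)\Big)dt,\\ \Sigma_5(u)&=\int_0^1\Big(D_2^5f(t,u(t))\,w(t)^4-5D_2^4f(t,u(t))\,w(t)^3A(t)+5D_2^3f(t,u(t))\,w(t)^2A(t)^2\Big)dt.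 \end{aligned}$$ **Proposition.** For $k=1,\dots,5$, $$S_k=\{u\in B^1:\ \Sigma_i(u)=0,\ i=1,\dots,k\}.$$ Furthermore, for $k=1,\dots,4$, a point $u\in B^1$ is a Morin singularity of order $k$ of $F$ if and only if (a) $\Sigma_i(u)=0$ for $i=1,\dots,k$; (b) $\Sigma_{k+1}(u)\neq0$; (c) the derivative at $u$ of the map $B^1\to\mathbb R^{k-1}$, $v\mapsto(\Sigma_1(v),\dots,\Sigma_{k-1}(v))$, is surjective. -/

import Mathlib

open MeasureTheory
open scoped ContDiff

noncomputable section

namespace CircleODE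

/-! ### Morin singularities of maps between Banach spaces -/

section Morin

universe u

variable {Z₁ Z₂ : Type u} [NormedAddCommGroup Z₁] [NormedSpace ℝ Z₁]
  [NormedAddCommGroup Z₂] [NormedSpace ℝ Z₂]

/-- Adapted coordinates for `G : Z₁ → Z₂` near `z₀`: smooth changes of variables `α` in the domain,
near `z₀`, and `β` in the image, near `G z₀`, in which `G` takes the form
`(x, y) ↦ (x, μ (x, y))` with `x` in a Banach space `X` and `y` real. -/
structure AdaptedCoordinates (G : Z₁ → Z₂) (z₀ : Z₁)
    (X : Type u) [NormedAddCommGroup X] [NormedSpace ℝ X] where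
  /-- the change of variables in the domain -/
  α : OpenPartialHomeomorph Z₁ (X × ℝ)
  /-- the change of variables in the image -/
  β : OpenPartialHomeomorph Z₂ (X × ℝ)
  mem_source : z₀ ∈ α.source
  mapsTo : Set.MapsTo G α.source β.source
  contDiffOn_α : ContDiffOn ℝ ∞ α α.source
  contDiffOn_α_symm : ContDiffOn ℝ ∞ α.symm α.target
  contDiffOn_β : ContDiffOn ℝ ∞ β β.source
  contDiffOn_β_symm : ContDiffOn ℝ ∞ β.symm β.target
  fst_eq : ∀ z ∈ α.source, (β (G z)).1 = (α z).1

/-- The last component `μ` of `G` in adapted coordinates, `β ∘ G ∘ α⁻¹ = (x, y) ↦ (x, μ (x, y))`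
(meaningful on the open set `α.target`). -/
def AdaptedCoordinates.μ {G : Z₁ → Z₂} {z₀ : Z₁}
    {X : Type u} [NormedAddCommGroup X] [NormedSpace ℝ X]
    (A : AdaptedCoordinates G z₀ X) (p : X × ℝ) : ℝ :=
  (A.β (G (A.α.symm p))).2

/-- The partial derivative `D₂ⁱ μ` of a function `μ : X × ℝ → ℝ` with respect to its last,
real, variable. -/
def dLast {X : Type u} (μ : X × ℝ → ℝ) (i : ℕ) (p : X × ℝ) : ℝ :=
  iteratedDeriv i (fun y : ℝ => μ (p.1, y)) p.2

/-- `z₀` is a Morin singularity of order `k` of the smooth map `G`: the derivative `DG(z₀)` is a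
Fredholm operator of index `0` with kernel of dimension `1` and, in adapted coordinates
`(x, y) ↦ (x, μ (x, y))`, at the point `p` which corresponds to `z₀`,
* `D₂ μ = ⋯ = D₂ᵏ μ = 0`,
* `D₂ᵏ⁺¹ μ ≠ 0`,
* the derivative of `(D₂ μ, …, D₂ᵏ⁻¹ μ)` is surjective. -/
def IsMorinSingularity (G : Z₁ → Z₂) (k : ℕ) (z₀ : Z₁) : Prop :=
  ContDiff ℝ ∞ G ∧
  (fderiv ℝ G z₀).IsFredholm ∧
  Module.finrank ℝ (fderiv ℝ G z₀).ker = 1 ∧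
  Module.finrank ℝ (Z₂ ⧸ (fderiv ℝ G z₀).range) = 1 ∧
  ∃ (X : Type u) (_ : NormedAddCommGroup X) (_ : NormedSpace ℝ X) (_ : CompleteSpace X)
    (A : AdaptedCoordinates G z₀ X),
    (∀ i, 1 ≤ i → i ≤ k → dLast A.μ i (A.α z₀) = 0) ∧
    dLast A.μ (k + 1) (A.α z₀) ≠ 0 ∧
    Function.Surjective
      (fderiv ℝ (fun (p : X × ℝ) (i : Fin (k - 1)) => dLast A.μ (i + 1) p) (A.α z₀))

end Morin

/-! ### Function spaces on the circle `𝕊¹ = ℝ / ℤ` -/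

/-- `C⁰(𝕊¹)`, with the sup norm. -/
abbrev C0 : Type := C(UnitAddCircle, ℝ)

/-- `L²(𝕊¹)`. -/
abbrev L2 : Type := Lp ℝ 2 (volume : Measure UnitAddCircle)

/-- `C¹(𝕊¹)` as the space of pairs `(u, u')` with `u'` the (continuous) derivative of `u`; the
norm is `max (sup |u|) (sup |u'|)`. -/
def C1 : Submodule ℝ (C0 × C0) where
  carrier := {p | ∀ t : ℝ, HasDerivAt (fun s : ℝ => p.1 (s : UnitAddCircle))
    (p.2 (t : UnitAddCircle)) t}
  add_mem' := fun hp hq t => (hp t).add (hq t)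
  zero_mem' := fun t => hasDerivAt_const t (0 : ℝ)
  smul_mem' := fun c _ hp t => (hp t).const_mul c

/-- Almost everywhere equality on the circle, read on the fundamental domain. -/
theorem ae_Ioc_of_ae {P : UnitAddCircle → Prop} (h : ∀ᵐ x, P x) :
    ∀ᵐ s : ℝ ∂(volume.restrict (Set.Ioc (0 : ℝ) 1)), P (s : UnitAddCircle) := by
  have h1 := UnitAddCircle.measurePreserving_mk 0
  rw [zero_add] at h1
  exact h1.quasiMeasurePreserving.ae h

theorem intervalIntegrable_L2 (v : L2) {t : ℝ} (ht : t ∈ Set.Icc (0 : ℝ) 1) :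
    IntervalIntegrable (fun s : ℝ => v (s : UnitAddCircle)) volume 0 t := by
  have h1 := UnitAddCircle.measurePreserving_mk 0
  rw [zero_add] at h1
  have h2 : Integrable (v : UnitAddCircle → ℝ) volume :=
    (Lp.memLp v).integrable (by norm_num)
  have h3 := h1.integrable_comp_of_integrable h2
  rw [intervalIntegrable_iff_integrableOn_Ioc_of_le ht.1]
  exact IntegrableOn.mono_set h3 (Set.Ioc_subset_Ioc_right ht.2)

theorem integral_L2_congr {v w : ℝ → ℝ} {t : ℝ} (ht : t ∈ Set.Icc (0 : ℝ) 1)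
    (h : ∀ᵐ s : ℝ ∂(volume.restrict (Set.Ioc (0 : ℝ) 1)), v s = w s) :
    ∫ s in (0 : ℝ)..t, v s = ∫ s in (0 : ℝ)..t, w s := by
  rw [intervalIntegral.integral_of_le ht.1, intervalIntegral.integral_of_le ht.1]
  exact integral_congr_ae (ae_restrict_of_ae_restrict_of_subset (Set.Ioc_subset_Ioc_right ht.2) h)

/-- `H¹(𝕊¹)`, the space of periodic absolutely continuous functions with derivative in `L²`, as the
space of pairs `(u, u')` where `u` is a continuous function on the circle, `u' ∈ L²(𝕊¹)` and `u` is
the integral of `u'`. The norm is `max (sup |u|) ‖u'‖_{L²}`; it is equivalent to the usual Hilbert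
norm `(‖u‖² + ‖u'‖²)^{1/2}`, so that smoothness, derivatives and changes of variables have the same
meaning for both. -/
def H1 : Submodule ℝ (C0 × L2) where
  carrier := {p | ∀ t ∈ Set.Icc (0 : ℝ) 1,
    p.1 (t : UnitAddCircle) = p.1 ((0 : ℝ) : UnitAddCircle) +
      ∫ s in (0 : ℝ)..t, p.2 (s : UnitAddCircle)}
  add_mem' := by
    rintro ⟨u, v⟩ ⟨u', v'⟩ hp hq t ht
    have h1 := hp t ht
    have h2 := hq t ht
    have h3 := integral_L2_congr ht (ae_Ioc_of_ae (Lp.coeFn_add v v'))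
    simp only [Pi.add_apply] at h3
    rw [intervalIntegral.integral_add (intervalIntegrable_L2 v ht)
      (intervalIntegrable_L2 v' ht)] at h3
    simp only [Prod.mk_add_mk, ContinuousMap.add_apply] at h1 h2 ⊢
    rw [h3, h1, h2]
    ring
  zero_mem' := by
    intro t ht
    have h3 := integral_L2_congr ht
      (ae_Ioc_of_ae (Lp.coeFn_zero ℝ 2 (volume : Measure UnitAddCircle)))
    simp only [Prod.fst_zero, Prod.snd_zero, ContinuousMap.zero_apply]
    rw [h3]
    simp
  smul_mem' := by
    rintro c ⟨u, v⟩ hp t ht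
    have h1 := hp t ht
    have h3 := integral_L2_congr ht (ae_Ioc_of_ae (Lp.coeFn_smul c v))
    simp only [Pi.smul_apply, smul_eq_mul] at h3
    rw [intervalIntegral.integral_const_mul] at h3
    simp only [Prod.smul_mk, ContinuousMap.smul_apply, smul_eq_mul] at h1 ⊢
    rw [h3, h1]
    ring

/-! ### The operator `F(u) = u' + f(t, u)` -/

/-- `f : 𝕊¹ × ℝ → ℝ` is smooth: its lift to `ℝ × ℝ` is `C^∞`. -/
def IsSmooth (f : UnitAddCircle → ℝ → ℝ) : Prop :=
  ContDiff ℝ ∞ (fun p : ℝ × ℝ => f (p.1 : UnitAddCircle) p.2)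

theorem IsSmooth.continuous {f : UnitAddCircle → ℝ → ℝ} (hf : IsSmooth f) :
    Continuous (fun p : UnitAddCircle × ℝ => f p.1 p.2) := by
  have hq : IsOpenQuotientMap (Prod.map ((↑) : ℝ → UnitAddCircle) (id : ℝ → ℝ)) :=
    QuotientAddGroup.isOpenQuotientMap_mk.prodMap IsOpenQuotientMap.id
  exact hq.continuous_comp_iff.1 (ContDiff.continuous hf)

/-- The function `t ↦ f(t, u(t))`. -/
def substitute (f : UnitAddCircle → ℝ → ℝ) (hf : IsSmooth f) (u : C0) : C0 where
  toFun t := f t (u t)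
  continuous_toFun := hf.continuous.comp (continuous_id.prodMk u.continuous)

/-- `F : C¹ → C⁰`, `F(u)(t) = u'(t) + f(t, u(t))`. -/
def opC (f : UnitAddCircle → ℝ → ℝ) (hf : IsSmooth f) (u : C1) : C0 :=
  u.1.2 + substitute f hf u.1.1

/-- `F : H¹ → L²`, `F(u)(t) = u'(t) + f(t, u(t))`. -/
def opH (f : UnitAddCircle → ℝ → ℝ) (hf : IsSmooth f) (u : H1) : L2 :=
  u.1.2 + ContinuousMap.toLp 2 volume ℝ (substitute f hf u.1.1)

/-! ### The strata `S_k` -/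

section Strata

variable {B₁ B₀ : Type} [NormedAddCommGroup B₁] [NormedSpace ℝ B₁]
  [NormedAddCommGroup B₀] [NormedSpace ℝ B₀]

/-- The map `Ψ(u) = ṽ + ū`, where `v = F(u)`, `ū` and `v̄` are the averages of `u` and `v`, and
`ṽ = v - v̄`. Here `avg₁`, `avg₀` are the averages on domain and image, and `one` is the constant
function `1`. -/
def Psi (F : B₁ → B₀) (avg₁ : B₁ → ℝ) (avg₀ : B₀ → ℝ) (one : B₀) (u : B₁) : B₀ :=
  (F u - avg₀ (F u) • one) + avg₁ u • one

/-- `φ`, the average of `F ∘ Ψ⁻¹`: in the coordinates given by `Ψ`, `F` is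
`ṽ + ū ↦ ṽ + φ(ṽ + ū)`. It is meaningful on the image of the injective map `Ψ`. -/
def phi (F : B₁ → B₀) (avg₁ : B₁ → ℝ) (avg₀ : B₀ → ℝ) (one : B₀) (v : B₀) : ℝ :=
  avg₀ (F (Function.invFun (Psi F avg₁ avg₀ one) v))

/-- `S_k`: the points `u` at which the partial derivatives `D₂ φ, …, D₂ᵏ φ` in the vertical
direction (that of the constant functions) vanish, in the coordinates given by `Ψ`. -/
def stratum (F : B₁ → B₀) (avg₁ : B₁ → ℝ) (avg₀ : B₀ → ℝ) (one : B₀) (k : ℕ) : Set B₁ :=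
  {u | ∀ i, 1 ≤ i → i ≤ k →
    iteratedDeriv i
      (fun a : ℝ => phi F avg₁ avg₀ one (Psi F avg₁ avg₀ one u + a • one)) 0 = 0}

end Strata

/-- `S_k` for `F : C¹ → C⁰`. -/
def stratumC (f : UnitAddCircle → ℝ → ℝ) (hf : IsSmooth f) (k : ℕ) : Set C1 :=
  stratum (opC f hf) (fun u => ∫ t, u.1.1 t) (fun v => ∫ t, v t) (1 : C0) k

/-- `S_k` for `F : H¹ → L²`. -/
def stratumH (f : UnitAddCircle → ℝ → ℝ) (hf : IsSmooth f) (k : ℕ) : Set H1 :=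
  stratum (opH f hf) (fun u => ∫ t, u.1.1 t) (fun v => ∫ t, v t)
    (ContinuousMap.toLp 2 volume ℝ (1 : C0)) k

/-! ### The functionals `Σ₁, …, Σ₅` -/

/-- `D₂ʲ f(t, u(t))`, as a function of `t ∈ ℝ`. -/
def D2 (f : UnitAddCircle → ℝ → ℝ) (j : ℕ) (u : C0) (t : ℝ) : ℝ :=
  iteratedDeriv j (f (t : UnitAddCircle)) (u (t : UnitAddCircle))

/-- The Green kernel `k(x) = x - ⌊x⌋ - 1/2`. -/
def green (x : ℝ) : ℝ := x - ⌊x⌋ - 1 / 2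

/-- `w(t) = exp (- ∫ k(s - t) D₂f(s, u(s)) ds)`. -/
def kerVec (f : UnitAddCircle → ℝ → ℝ) (u : C0) (t : ℝ) : ℝ :=
  Real.exp (-∫ s in (0 : ℝ)..1, green (s - t) * D2 f 1 u s)

/-- `∫₀ᵗ D₂²f(s, u(s)) w(s) ds`. -/
def primitiveW (f : UnitAddCircle → ℝ → ℝ) (u : C0) (t : ℝ) : ℝ :=
  ∫ s in (0 : ℝ)..t, D2 f 2 u s * kerVec f u s

/-- The functionals `Σ₁, …, Σ₅` (the value for other indices is never used). -/
def Sig (f : UnitAddCircle → ℝ → ℝ) : ℕ → C0 → ℝ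
  | 1, u => ∫ t in (0 : ℝ)..1, D2 f 1 u t
  | 2, u => ∫ t in (0 : ℝ)..1, D2 f 2 u t * kerVec f u t
  | 3, u => ∫ t in (0 : ℝ)..1, D2 f 3 u t * kerVec f u t ^ 2
  | 4, u => ∫ t in (0 : ℝ)..1,
      (D2 f 4 u t * kerVec f u t ^ 3
        - 2 * D2 f 3 u t * kerVec f u t ^ 2 * primitiveW f u t)
  | 5, u => ∫ t in (0 : ℝ)..1,
      (D2 f 5 u t * kerVec f u t ^ 4
        - 5 * D2 f 4 u t * kerVec f u t ^ 3 * primitiveW f u t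
        + 5 * D2 f 3 u t * kerVec f u t ^ 2 * primitiveW f u t ^ 2)
  | _, _ => 0

end CircleODE

end

/-
Let `W` be the vector field `u ↦ w_u`. A direct computation gives `DF(u) W(u) = Σ₁(u) w_u`, and
`DF` is injective where `Σ₁ ≠ 0`, while `w_u` is not in the range of `DF(u)` where `Σ₁(u) = 0`.
Hence `W` spans the kernel of `DF` along the critical set `Σ₁ = 0`. In coordinates adapted to `F`,
where `F` is `(x, y) ↦ (x, μ(x, y))`, it follows that `W` is a unit times `∂_y` up to a multiple
of `D₂μ`, and that `D₂μ` is a unit times `Σ₁`. Therefore the ideals of germs generated by `D₂μ, …,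
D₂ᵏμ` and by `Σ₁, WΣ₁, …, Wᵏ⁻¹Σ₁` coincide, and the Morin conditions depend only on these ideals.
It remains to differentiate `Σ₁` repeatedly along `W`: this gives `Σ₂` and `Σ₃` on the nose, and
`Σ₄` and `Σ₅` modulo the previous functionals.

Adapted coordinates are given by `Ψ`. The equations `DΨ(u) h = v` and `Ψ(u) - Ψ(v) = 0` are
integral equations `y + P(g y) = r`, with `P` the mean zero primitive, a compact operator; Rolle's
theorem and the Fredholm alternative show that they are uniquely solvable.
-/

noncomputable section

namespace CircleODE

open Filter Topology

/-! ### Ideals generated by the initial terms of a sequence -/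

section InitialIdeal

variable {R : Type*} [CommRing R]

/-- The ideal generated by the terms `p 0, …, p (k - 1)` of the sequence `p`. The conditions which
define a Morin singularity depend only on such ideals in the ring of germs of smooth functions. -/
def initialIdeal (p : ℕ → R) (k : ℕ) : Ideal R := Ideal.span (p '' Set.Iio k)

theorem mem_initialIdeal (p : ℕ → R) {i k : ℕ} (hi : i < k) : p i ∈ initialIdeal p k :=
  Ideal.subset_span ⟨i, hi, rfl⟩

theorem initialIdeal_le_iff {p : ℕ → R} {k : ℕ} {I : Ideal R} :
    initialIdeal p k ≤ I ↔ ∀ i < k, p i ∈ I := by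
  simp [initialIdeal, Ideal.span_le, Set.subset_def]

theorem initialIdeal_mono (p : ℕ → R) : Monotone (initialIdeal p) := fun _ _ h =>
  initialIdeal_le_iff.2 fun _ hi => mem_initialIdeal p (hi.trans_le h)

theorem derivation_mem_initialIdeal (D : Derivation ℤ R R) {p : ℕ → R} {k : ℕ} {x : R}
    (hD : ∀ i < k, D (p i) ∈ initialIdeal p (k + 1)) (hx : x ∈ initialIdeal p k) :
    D x ∈ initialIdeal p (k + 1) := by
  induction hx using Submodule.span_induction with
  | mem x hx =>
    obtain ⟨i, hi, rfl⟩ := hx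
    exact hD i hi
  | zero => simp
  | add x y _ _ hx hy => simpa using add_mem hx hy
  | smul a x hx ihx =>
    rw [smul_eq_mul, D.leibniz]
    exact add_mem (Ideal.mul_mem_left _ a ihx)
      (Ideal.mul_mem_right _ _ (initialIdeal_mono p k.le_succ hx))

/-- In adapted coordinates `D` is a vector field `b ∂_y + δ D'` and `p i` is the germ of
`∂_y ^ (i + 1) μ`, so that `D (p i) = b p (i + 1) + δ D' (p i)`. -/
theorem initialIdeal_eq_iterate_derivation (D : Derivation ℤ R R) {p : ℕ → R} {b δ : R}
    (hb : IsUnit b) (h0 : Associated (p 0) δ)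
    (hp : ∀ i, D (p i) - b * p (i + 1) ∈ Ideal.span {δ}) (k : ℕ) :
    initialIdeal p k = initialIdeal (fun i => D^[i] δ) k := by
  set q : ℕ → R := fun i => D^[i] δ
  have hDq (i : ℕ) : D (q i) = q (i + 1) := (Function.iterate_succ_apply' D i δ).symm
  apply le_antisymm
  · have hpq (i : ℕ) : p i ∈ initialIdeal q (i + 1) := by
      induction i with
      | zero => exact Ideal.mem_of_dvd _ h0.dvd' (mem_initialIdeal q zero_lt_one)
      | succ i ih =>
        have hDp : D (p i) ∈ initialIdeal q (i + 2) :=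
          derivation_mem_initialIdeal D
            (fun j hj => hDq j ▸ mem_initialIdeal q (Nat.succ_lt_succ hj)) ih
        have hδ : Ideal.span {δ} ≤ initialIdeal q (i + 2) :=
          (Ideal.span_singleton_le_iff_mem _).2 (mem_initialIdeal q (Nat.succ_pos _))
        rw [← Ideal.unit_mul_mem_iff_mem _ hb]
        simpa using sub_mem hDp (hδ (hp i))
    exact initialIdeal_le_iff.2 fun i hi => initialIdeal_mono q hi (hpq i)
  · have hδ {k : ℕ} (hk : 0 < k) : δ ∈ initialIdeal p k :=
      Ideal.mem_of_dvd _ h0.dvd (mem_initialIdeal p hk)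
    have hDp {i k : ℕ} (hi : i + 1 < k) : D (p i) ∈ initialIdeal p k := by
      have hle : Ideal.span {δ} ≤ initialIdeal p k :=
        (Ideal.span_singleton_le_iff_mem _).2 (hδ (by omega))
      simpa using add_mem (hle (hp i)) (Ideal.mul_mem_left _ b (mem_initialIdeal p hi))
    have hqp (i : ℕ) : q i ∈ initialIdeal p (i + 1) := by
      induction i with
      | zero => exact hδ zero_lt_one
      | succ i ih =>
        rw [← hDq]
        exact derivation_mem_initialIdeal D (fun j hj => hDp (Nat.succ_lt_succ hj)) ih
    exact initialIdeal_le_iff.2 fun i hi => initialIdeal_mono p hi (hqp i)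

end InitialIdeal

theorem surjective_iff_of_ker_eq {K V W : Type*} [DivisionRing K] [AddCommGroup V] [Module K V]
    [AddCommGroup W] [Module K W] [FiniteDimensional K W] {f g : V →ₗ[K] W}
    (h : f.ker = g.ker) : Function.Surjective f ↔ Function.Surjective g := by
  have key (f : V →ₗ[K] W) :
      Function.Surjective f ↔ Module.finrank K (V ⧸ f.ker) = Module.finrank K W := by
    rw [← LinearMap.range_eq_top, f.quotKerEquivRange.finrank_eq]
    exact ⟨fun h => by rw [h, finrank_top], Submodule.eq_top_of_finrank_eq⟩
  rw [key, key, h]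

/-! ### Germs of smooth functions -/

section Germs

variable {Z : Type*} [NormedAddCommGroup Z] [NormedSpace ℝ Z] {z₀ : Z}

/-- The ring of germs at `z₀` of smooth real functions. -/
def smoothGerms (z₀ : Z) : Subring (Germ (𝓝 z₀) ℝ) where
  carrier := {x | ∃ g : Z → ℝ, ContDiffAt ℝ ∞ g z₀ ∧ (g : Germ (𝓝 z₀) ℝ) = x}
  zero_mem' := ⟨0, contDiffAt_const, rfl⟩
  one_mem' := ⟨1, contDiffAt_const, rfl⟩
  add_mem' := by
    rintro _ _ ⟨g, hg, rfl⟩ ⟨h, hh, rfl⟩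
    exact ⟨g + h, hg.add hh, rfl⟩
  mul_mem' := by
    rintro _ _ ⟨g, hg, rfl⟩ ⟨h, hh, rfl⟩
    exact ⟨g * h, hg.mul hh, rfl⟩
  neg_mem' := by
    rintro _ ⟨g, hg, rfl⟩
    exact ⟨-g, hg.neg, rfl⟩

namespace smoothGerms

/-- The germ of a function which is smooth at `z₀`. -/
def mk {g : Z → ℝ} (hg : ContDiffAt ℝ ∞ g z₀) : smoothGerms z₀ := ⟨g, g, hg, rfl⟩

theorem mk_eq_mk_iff {g h : Z → ℝ} {hg : ContDiffAt ℝ ∞ g z₀} {hh : ContDiffAt ℝ ∞ h z₀} :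
    mk hg = mk hh ↔ g =ᶠ[𝓝 z₀] h :=
  Subtype.ext_iff.trans Germ.coe_eq

theorem exists_mk_eq (x : smoothGerms z₀) :
    ∃ (g : Z → ℝ) (hg : ContDiffAt ℝ ∞ g z₀), mk hg = x := by
  obtain ⟨_, g, hg, rfl⟩ := x
  exact ⟨g, hg, rfl⟩

/-- The value at `z₀` of the germ of a smooth function. -/
def eval (z₀ : Z) : smoothGerms z₀ →+* ℝ := Germ.valueRingHom.comp (smoothGerms z₀).subtype

@[simp]
theorem eval_mk {g : Z → ℝ} (hg : ContDiffAt ℝ ∞ g z₀) : eval z₀ (mk hg) = g z₀ := rfl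

theorem isUnit_mk {g : Z → ℝ} (hg : ContDiffAt ℝ ∞ g z₀) (h0 : g z₀ ≠ 0) : IsUnit (mk hg) := by
  refine IsUnit.of_mul_eq_one (mk (hg.inv h0)) (mk_eq_mk_iff (hg := hg.mul (hg.inv h0))
    (hh := contDiffAt_const (c := 1)) |>.2 ?_)
  filter_upwards [hg.continuousAt.eventually_ne h0] with z hz
  exact mul_inv_cancel₀ hz

end smoothGerms

/-- The derivative of `g` along the vector field `ν`. -/
def along (ν : Z → Z) (g : Z → ℝ) (z : Z) : ℝ := fderiv ℝ g z (ν z)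

theorem contDiffAt_along {ν : Z → Z} {g : Z → ℝ} (hν : ContDiffAt ℝ ∞ ν z₀)
    (hg : ContDiffAt ℝ ∞ g z₀) : ContDiffAt ℝ ∞ (along ν g) z₀ :=
  (hg.fderiv_right (m := ∞) (by simp)).clm_apply hν

theorem contDiffAt_iterate_along {ν : Z → Z} {g : Z → ℝ} (hν : ContDiffAt ℝ ∞ ν z₀)
    (hg : ContDiffAt ℝ ∞ g z₀) (i : ℕ) : ContDiffAt ℝ ∞ ((along ν)^[i] g) z₀ := by
  induction i with
  | zero => exact hg
  | succ i ih =>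
    rw [Function.iterate_succ_apply']
    exact contDiffAt_along hν ih

theorem eventually_differentiableAt {g : Z → ℝ} (hg : ContDiffAt ℝ ∞ g z₀) :
    ∀ᶠ z in 𝓝 z₀, DifferentiableAt ℝ g z := by
  filter_upwards [(hg.of_le (m := 1) (by exact_mod_cast le_top)).eventually (by simp)] with z hz
  exact hz.differentiableAt one_ne_zero

theorem along_congr (ν : Z → Z) {g h : Z → ℝ} (hgh : g =ᶠ[𝓝 z₀] h) :
    along ν g =ᶠ[𝓝 z₀] along ν h := by
  filter_upwards [hgh.fderiv (𝕜 := ℝ)] with z hz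
  simp only [along, hz]

theorem along_add (ν : Z → Z) {g h : Z → ℝ} (hg : ContDiffAt ℝ ∞ g z₀)
    (hh : ContDiffAt ℝ ∞ h z₀) : along ν (g + h) =ᶠ[𝓝 z₀] along ν g + along ν h := by
  filter_upwards [eventually_differentiableAt hg, eventually_differentiableAt hh] with z hg hh
  simp [along, fderiv_add hg hh]

theorem along_mul (ν : Z → Z) {g h : Z → ℝ} (hg : ContDiffAt ℝ ∞ g z₀)
    (hh : ContDiffAt ℝ ∞ h z₀) :
    along ν (g * h) =ᶠ[𝓝 z₀] g * along ν h + h * along ν g := by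
  filter_upwards [eventually_differentiableAt hg, eventually_differentiableAt hh] with z hg hh
  simp [along, fderiv_mul hg hh]

theorem iterate_along_comp_clm {E : Type*}
    [NormedAddCommGroup E] [NormedSpace ℝ E] (L : Z →L[ℝ] E) {ν : Z → Z} {W : E → E}
    (hL : ∀ z, L (ν z) = W (L z)) (hW : ContDiff ℝ ∞ W) {g : E → ℝ} (hg : ContDiff ℝ ∞ g) (i : ℕ) :
    (along ν)^[i] (fun z => g (L z)) = fun z => (along W)^[i] g (L z) := by
  induction i with
  | zero => rfl
  | succ i ih =>
    ext z
    have hdiff : DifferentiableAt ℝ ((along W)^[i] g) (L z) :=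
      (contDiffAt_iterate_along hW.contDiffAt hg.contDiffAt i).differentiableAt (by simp)
    rw [Function.iterate_succ_apply', Function.iterate_succ_apply', ih, along,
      fderiv_fun_comp z hdiff L.differentiableAt, L.fderiv]
    simp [along, hL]

namespace smoothGerms

/-- The derivation of the ring of germs of smooth functions given by a vector field. -/
def derivation {ν : Z → Z} (hν : ContDiffAt ℝ ∞ ν z₀) :
    Derivation ℤ (smoothGerms z₀) (smoothGerms z₀) :=
  .mk' (AddMonoidHom.toIntLinearMap <| .mk'
    (fun x => ⟨Germ.map' (along ν) (fun _ _ h => along_congr ν h) x, by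
      obtain ⟨g, hg, rfl⟩ := exists_mk_eq x
      exact ⟨along ν g, contDiffAt_along hν hg, rfl⟩⟩)
    (fun x y => by
      obtain ⟨g, hg, rfl⟩ := exists_mk_eq x
      obtain ⟨h, hh, rfl⟩ := exists_mk_eq y
      exact Subtype.ext (Germ.coe_eq.2 (along_add ν hg hh))))
    (fun x y => by
      obtain ⟨g, hg, rfl⟩ := exists_mk_eq x
      obtain ⟨h, hh, rfl⟩ := exists_mk_eq y
      exact Subtype.ext (Germ.coe_eq.2 (along_mul ν hg hh)))

theorem derivation_mk {ν : Z → Z} (hν : ContDiffAt ℝ ∞ ν z₀) {g : Z → ℝ}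
    (hg : ContDiffAt ℝ ∞ g z₀) : derivation hν (mk hg) = mk (contDiffAt_along hν hg) := rfl

theorem derivation_iterate_mk {ν : Z → Z} (hν : ContDiffAt ℝ ∞ ν z₀) {g : Z → ℝ}
    (hg : ContDiffAt ℝ ∞ g z₀) (i : ℕ) :
    (derivation hν)^[i] (mk hg) = mk (contDiffAt_iterate_along hν hg i) := by
  induction i with
  | zero => rfl
  | succ i ih =>
    rw [Function.iterate_succ_apply', ih, derivation_mk]
    exact mk_eq_mk_iff.2 (by rw [Function.iterate_succ_apply'])

/-- The germs which vanish at `z₀` together with their derivative in the direction `v`. -/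
def singularIdeal (z₀ v : Z) : Ideal (smoothGerms z₀) where
  carrier := {x | eval z₀ x = 0 ∧ eval z₀ (derivation (contDiffAt_const (c := v)) x) = 0}
  zero_mem' := by simp
  add_mem' := by
    rintro x y ⟨hx, hx'⟩ ⟨hy, hy'⟩
    simp [hx, hx', hy, hy']
  smul_mem' := by
    rintro a x ⟨hx, hx'⟩
    simp [hx, hx']

theorem mk_mem_singularIdeal_iff {v : Z} {g : Z → ℝ} (hg : ContDiffAt ℝ ∞ g z₀) :
    mk hg ∈ singularIdeal z₀ v ↔ g z₀ = 0 ∧ fderiv ℝ g z₀ v = 0 := Iff.rfl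

variable {p q : ℕ → Z → ℝ} {hp : ∀ i, ContDiffAt ℝ ∞ (p i) z₀} {hq : ∀ i, ContDiffAt ℝ ∞ (q i) z₀}
  {k : ℕ}

theorem forall_eq_zero_iff_of_initialIdeal_eq
    (h : initialIdeal (fun i => mk (hp i)) k = initialIdeal (fun i => mk (hq i)) k) :
    (∀ i < k, p i z₀ = 0) ↔ ∀ i < k, q i z₀ = 0 := by
  have key {r : ℕ → Z → ℝ} (hr : ∀ i, ContDiffAt ℝ ∞ (r i) z₀) :
      (∀ i < k, r i z₀ = 0) ↔ initialIdeal (fun i => mk (hr i)) k ≤ RingHom.ker (eval z₀) := by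
    simp [initialIdeal_le_iff]
  rw [key hp, key hq, h]

theorem surjective_fderiv_iff_of_initialIdeal_eq
    (h : initialIdeal (fun i => mk (hp i)) k = initialIdeal (fun i => mk (hq i)) k)
    (h0 : ∀ i < k, q i z₀ = 0) :
    Function.Surjective (fderiv ℝ (fun z (i : Fin k) => p i z) z₀) ↔
      Function.Surjective (fderiv ℝ (fun z (i : Fin k) => q i z) z₀) := by
  have key {r : ℕ → Z → ℝ} (hr : ∀ i, ContDiffAt ℝ ∞ (r i) z₀) (hr0 : ∀ i < k, r i z₀ = 0)
      (v : Z) : v ∈ (fderiv ℝ (fun z (i : Fin k) => r i z) z₀).ker ↔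
        initialIdeal (fun i => mk (hr i)) k ≤ singularIdeal z₀ v := by
    rw [initialIdeal_le_iff, LinearMap.mem_ker, ContinuousLinearMap.coe_coe,
      fderiv_pi fun i : Fin k => (hr i).differentiableAt (by simp)]
    simp +contextual [funext_iff, Fin.forall_iff, mk_mem_singularIdeal_iff, hr0]
  refine surjective_iff_of_ker_eq (Submodule.ext fun v => ?_)
  rw [key hp ((forall_eq_zero_iff_of_initialIdeal_eq h).2 h0), key hq h0, h]

end smoothGerms

end Germs

/-! ### Adapted coordinates and a vector field spanning the kernel -/

section Adapted

universe u

variable {Z₁ Z₂ X : Type u} [NormedAddCommGroup Z₁] [NormedSpace ℝ Z₁]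
  [NormedAddCommGroup Z₂] [NormedSpace ℝ Z₂] [NormedAddCommGroup X] [NormedSpace ℝ X]

theorem bijective_fderiv_of_contDiffOn (e : OpenPartialHomeomorph Z₁ Z₂)
    (he : ContDiffOn ℝ ∞ e e.source) (hs : ContDiffOn ℝ ∞ e.symm e.target)
    {z : Z₁} (hz : z ∈ e.source) : Function.Bijective (fderiv ℝ e z) := by
  have hdz : HasFDerivAt e (fderiv ℝ e z) z :=
    ((he.contDiffAt (e.open_source.mem_nhds hz)).differentiableAt (by simp)).hasFDerivAt
  have hdez : HasFDerivAt e.symm (fderiv ℝ e.symm (e z)) (e z) :=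
    ((hs.contDiffAt (e.open_target.mem_nhds (e.map_source hz))).differentiableAt
      (by simp)).hasFDerivAt
  have hleft := (hdez.comp z hdz).unique
    ((hasFDerivAt_id z).congr_of_eventuallyEq (e.eventually_left_inverse hz))
  have hdz' : HasFDerivAt e (fderiv ℝ e z) (e.symm (e z)) := (e.left_inv hz).symm ▸ hdz
  have hright := (hdz'.comp (e z) hdez).unique ((hasFDerivAt_id (e z)).congr_of_eventuallyEq
    (e.eventually_right_inverse (e.map_source hz)))
  exact ⟨Function.LeftInverse.injective (DFunLike.congr_fun hleft),
    Function.RightInverse.surjective (DFunLike.congr_fun hright)⟩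

theorem dLast_succ {μ : X × ℝ → ℝ} {i : ℕ} {p : X × ℝ}
    (h : DifferentiableAt ℝ (dLast μ i) p) :
    dLast μ (i + 1) p = fderiv ℝ (dLast μ i) p (0, 1) := by
  have hline : HasDerivAt (fun y : ℝ => (p.1, y)) ((0 : X), (1 : ℝ)) p.2 :=
    (hasDerivAt_const _ _).prodMk (hasDerivAt_id _)
  have hcomp := (show HasFDerivAt (dLast μ i) (fderiv ℝ (dLast μ i) p) (p.1, p.2) from
    h.hasFDerivAt).comp_hasDerivAt p.2 hline
  rw [← hcomp.deriv, dLast, iteratedDeriv_succ]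
  rfl

theorem contDiffOn_dLast {μ : X × ℝ → ℝ} {s : Set (X × ℝ)} (hs : IsOpen s)
    (hμ : ContDiffOn ℝ ∞ μ s) (i : ℕ) : ContDiffOn ℝ ∞ (dLast μ i) s := by
  induction i with
  | zero => exact hμ.congr fun p _ => by simp [dLast]
  | succ i ih =>
    have h : ContDiffOn ℝ ∞ (fun p => fderiv ℝ (dLast μ i) p (0, 1)) s :=
      (ih.fderiv_of_isOpen hs (by simp)).clm_apply contDiffOn_const
    exact h.congr fun p hp => dLast_succ <|
      (ih.contDiffAt (hs.mem_nhds hp)).differentiableAt (by simp)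

namespace AdaptedCoordinates

variable {G : Z₁ → Z₂} {z₀ : Z₁} (A : AdaptedCoordinates G z₀ X) {z : Z₁}

theorem contDiffAt_α (hz : z ∈ A.α.source) : ContDiffAt ℝ ∞ A.α z :=
  A.contDiffOn_α.contDiffAt (A.α.open_source.mem_nhds hz)

theorem contDiffAt_β (hz : z ∈ A.α.source) : ContDiffAt ℝ ∞ A.β (G z) :=
  A.contDiffOn_β.contDiffAt (A.β.open_source.mem_nhds (A.mapsTo hz))

theorem bijective_fderiv_α (hz : z ∈ A.α.source) : Function.Bijective (fderiv ℝ A.α z) :=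
  bijective_fderiv_of_contDiffOn A.α A.contDiffOn_α A.contDiffOn_α_symm hz

theorem bijective_fderiv_β (hz : z ∈ A.α.source) : Function.Bijective (fderiv ℝ A.β (G z)) :=
  bijective_fderiv_of_contDiffOn A.β A.contDiffOn_β A.contDiffOn_β_symm (A.mapsTo hz)

theorem contDiffOn_μ (hG : ContDiff ℝ ∞ G) : ContDiffOn ℝ ∞ A.μ A.α.target :=
  contDiff_snd.comp_contDiffOn <| A.contDiffOn_β.comp (hG.comp_contDiffOn A.contDiffOn_α_symm)
    fun _ hp => A.mapsTo (A.α.map_target hp)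

theorem contDiffAt_dLast (hG : ContDiff ℝ ∞ G) (i : ℕ) (hz : z ∈ A.α.source) :
    ContDiffAt ℝ ∞ (dLast A.μ i) (A.α z) :=
  (contDiffOn_dLast A.α.open_target (A.contDiffOn_μ hG) i).contDiffAt
    (A.α.open_target.mem_nhds (A.α.map_source hz))

theorem differentiableAt_dLast (hG : ContDiff ℝ ∞ G) (i : ℕ) (hz : z ∈ A.α.source) :
    DifferentiableAt ℝ (dLast A.μ i) (A.α z) :=
  (A.contDiffAt_dLast hG i hz).differentiableAt (by simp)

theorem contDiffAt_dLast_comp (hG : ContDiff ℝ ∞ G) (i : ℕ) (hz : z ∈ A.α.source) :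
    ContDiffAt ℝ ∞ (fun z => dLast A.μ i (A.α z)) z :=
  (A.contDiffAt_dLast hG i hz).comp z (A.contDiffAt_α hz)

theorem contDiffAt_fderiv_dLast_comp (hG : ContDiff ℝ ∞ G) (i : ℕ) (hz : z ∈ A.α.source) :
    ContDiffAt ℝ ∞ (fun z => fderiv ℝ (dLast A.μ i) (A.α z)) z :=
  ((A.contDiffAt_dLast hG i hz).fderiv_right (m := ∞) (by simp)).comp z (A.contDiffAt_α hz)

theorem fderiv_dLast_comp (hG : ContDiff ℝ ∞ G) (i : ℕ) (hz : z ∈ A.α.source) (v : Z₁) :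
    fderiv ℝ (fun z => dLast A.μ i (A.α z)) z v =
      fderiv ℝ (dLast A.μ i) (A.α z) (fderiv ℝ A.α z v) :=
  DFunLike.congr_fun ((A.differentiableAt_dLast hG i hz).hasFDerivAt.comp z
    ((A.contDiffAt_α hz).differentiableAt (by simp)).hasFDerivAt).fderiv v

theorem fderiv_β_fderiv (hG : ContDiff ℝ ∞ G) (hz : z ∈ A.α.source) (v : Z₁) :
    fderiv ℝ A.β (G z) (fderiv ℝ G z v) =
      ((fderiv ℝ A.α z v).1, fderiv ℝ (dLast A.μ 0) (A.α z) (fderiv ℝ A.α z v)) := by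
  have hα := ((A.contDiffAt_α hz).differentiableAt (by simp)).hasFDerivAt
  have hβ := ((A.contDiffAt_β hz).differentiableAt (by simp)).hasFDerivAt
  have hμ := (A.differentiableAt_dLast hG 0 hz).hasFDerivAt
  have hform : (A.β ∘ G) =ᶠ[𝓝 z] fun z => ((A.α z).1, (dLast A.μ 0 ∘ A.α) z) := by
    filter_upwards [A.α.open_source.mem_nhds hz] with y hy
    exact Prod.ext (A.fst_eq y hy)
      (by simp [dLast, AdaptedCoordinates.μ, A.α.left_inv hy])
  exact DFunLike.congr_fun ((hβ.comp z (hG.differentiable (by simp) z).hasFDerivAt).unique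
    ((hα.fst.prodMk (hμ.comp z hα)).congr_of_eventuallyEq hform)) v

/-- The component of `w` transverse to the image of the hyperplane `X × {0}` under the derivative
of `(x, y) ↦ (x, μ (x, y))`. -/
def transverse (z : Z₁) (w : Z₂) : ℝ :=
  (fderiv ℝ A.β (G z) w).2 - fderiv ℝ (dLast A.μ 0) (A.α z) ((fderiv ℝ A.β (G z) w).1, 0)

theorem transverse_ne_zero (hG : ContDiff ℝ ∞ G) (hz : z ∈ A.α.source) {w : Z₂}
    (hw : w ∉ Set.range (fderiv ℝ G z)) : A.transverse z w ≠ 0 := by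
  intro h0
  obtain ⟨v, hv⟩ := (A.bijective_fderiv_α hz).surjective ((fderiv ℝ A.β (G z) w).1, 0)
  refine hw ⟨v, (A.bijective_fderiv_β hz).injective ?_⟩
  rw [A.fderiv_β_fderiv hG hz, hv, ← sub_eq_zero.1 h0]

theorem fderiv_α_eq (hG : ContDiff ℝ ∞ G) (hz : z ∈ A.α.source) {v : Z₁} {w : Z₂} {c : ℝ}
    (h : fderiv ℝ G z v = c • w) :
    fderiv ℝ A.α z v =
      (fderiv ℝ A.α z v).2 • ((0 : X), (1 : ℝ)) + c • ((fderiv ℝ A.β (G z) w).1, (0 : ℝ)) := by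
  have hβ := A.fderiv_β_fderiv hG hz v
  rw [h, map_smul] at hβ
  exact Prod.ext (by simpa using (congrArg Prod.fst hβ).symm) (by simp)

theorem fderiv_α_snd_ne_zero (hG : ContDiff ℝ ∞ G) (hz : z ∈ A.α.source) {v : Z₁} (hv : v ≠ 0)
    (h : fderiv ℝ G z v = 0) : (fderiv ℝ A.α z v).2 ≠ 0 := by
  intro h0
  have hα := A.fderiv_α_eq hG hz (w := 0) (c := 0) (by rw [h, zero_smul])
  rw [h0, zero_smul, zero_smul, add_zero,
    map_eq_zero_iff _ (A.bijective_fderiv_α hz).injective] at hα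
  exact hv hα

theorem mul_dLast_one_eq (hG : ContDiff ℝ ∞ G) (hz : z ∈ A.α.source) {v : Z₁} {w : Z₂} {c : ℝ}
    (h : fderiv ℝ G z v = c • w) :
    (fderiv ℝ A.α z v).2 * dLast A.μ 1 (A.α z) = c * A.transverse z w := by
  have hβ := congrArg Prod.snd (A.fderiv_β_fderiv hG hz v)
  rw [h, map_smul, A.fderiv_α_eq hG hz h, map_add, map_smul, map_smul,
    ← dLast_succ (A.differentiableAt_dLast hG 0 hz)] at hβ
  simp only [Prod.smul_snd, smul_eq_mul] at hβ
  rw [transverse]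
  linarith

theorem dLast_one_ne_zero (hG : ContDiff ℝ ∞ G) (hz : z ∈ A.α.source)
    (hinj : Function.Injective (fderiv ℝ G z)) : dLast A.μ 1 (A.α z) ≠ 0 := by
  rw [dLast_succ (A.differentiableAt_dLast hG 0 hz)]
  intro h0
  obtain ⟨v, hv⟩ := (A.bijective_fderiv_α hz).surjective (0, 1)
  have hβ := A.fderiv_β_fderiv hG hz v
  rw [hv, h0, Prod.mk_zero_zero, map_eq_zero_iff _ (A.bijective_fderiv_β hz).injective,
    map_eq_zero_iff _ hinj] at hβ
  simpa [hβ] using congrArg Prod.snd hv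

section KernelField

variable {ν : Z₁ → Z₁} {n : Z₁ → Z₂} {δ : Z₁ → ℝ}

theorem initialIdeal_dLast_eq (hG : ContDiff ℝ ∞ G) (hν : ContDiffAt ℝ ∞ ν z₀)
    (hn : ContDiffAt ℝ ∞ n z₀) (hδ : ContDiffAt ℝ ∞ δ z₀)
    (h : ∀ᶠ z in 𝓝 z₀, fderiv ℝ G z (ν z) = δ z • n z) (hν0 : ν z₀ ≠ 0)
    (hn0 : n z₀ ∉ Set.range (fderiv ℝ G z₀)) (hδ0 : δ z₀ = 0) (k : ℕ) :
    initialIdeal (fun i => smoothGerms.mk (A.contDiffAt_dLast_comp hG (i + 1) A.mem_source)) k =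
      initialIdeal (fun i => smoothGerms.mk (contDiffAt_iterate_along hν hδ i)) k := by
  have hz₀ := A.mem_source
  have hb : ContDiffAt ℝ ∞ (fun z => (fderiv ℝ A.α z (ν z)).2) z₀ :=
    (((A.contDiffAt_α hz₀).fderiv_right (m := ∞) (by simp)).clm_apply hν).snd
  have hn' : ContDiffAt ℝ ∞ (fun z => fderiv ℝ A.β (G z) (n z)) z₀ :=
    (((A.contDiffAt_β hz₀).fderiv_right (m := ∞) (by simp)).comp z₀ hG.contDiffAt).clm_apply hn
  have hc (i : ℕ) : ContDiffAt ℝ ∞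
      (fun z => fderiv ℝ (dLast A.μ i) (A.α z) ((fderiv ℝ A.β (G z) (n z)).1, 0)) z₀ :=
    (A.contDiffAt_fderiv_dLast_comp hG i hz₀).clm_apply (hn'.fst.prodMk contDiffAt_const)
  have hr : ContDiffAt ℝ ∞ (fun z => A.transverse z (n z)) z₀ := hn'.snd.sub (hc 0)
  have hDG0 : fderiv ℝ G z₀ (ν z₀) = 0 := by rw [h.self_of_nhds, hδ0, zero_smul]
  have hbU := smoothGerms.isUnit_mk hb (A.fderiv_α_snd_ne_zero hG hz₀ hν0 hDG0)
  have hrU := smoothGerms.isUnit_mk hr (A.transverse_ne_zero hG hz₀ hn0)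
  simp only [← smoothGerms.derivation_iterate_mk hν hδ]
  refine initialIdeal_eq_iterate_derivation _ hbU ?_ (fun i => ?_) k
  · have hbμ : smoothGerms.mk hb * smoothGerms.mk (A.contDiffAt_dLast_comp hG 1 hz₀) =
        smoothGerms.mk hδ * smoothGerms.mk hr := by
      refine (smoothGerms.mk_eq_mk_iff (hg := hb.mul (A.contDiffAt_dLast_comp hG 1 hz₀))
        (hh := hδ.mul hr)).2 ?_
      filter_upwards [A.α.open_source.mem_nhds hz₀, h] with z hz h
      exact A.mul_dLast_one_eq hG hz h
    exact ((associated_unit_mul_left _ _ hbU).symm.trans (Associated.of_eq hbμ)).trans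
      (associated_mul_unit_left _ _ hrU)
  · refine Ideal.mem_span_singleton.2 ⟨smoothGerms.mk (hc (i + 1)), sub_eq_iff_eq_add.2 ?_⟩
    refine (smoothGerms.mk_eq_mk_iff
      (hg := contDiffAt_along hν (A.contDiffAt_dLast_comp hG (i + 1) hz₀))
      (hh := (hδ.mul (hc (i + 1))).add (hb.mul (A.contDiffAt_dLast_comp hG (i + 2) hz₀)))).2 ?_
    filter_upwards [A.α.open_source.mem_nhds hz₀, h] with z hz h
    rw [along, A.fderiv_dLast_comp hG (i + 1) hz, A.fderiv_α_eq hG hz h, map_add, map_smul,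
      map_smul, ← dLast_succ (A.differentiableAt_dLast hG (i + 1) hz)]
    simp only [Prod.snd_add, Prod.smul_snd, smul_eq_mul, mul_one, mul_zero, add_zero]
    ring

theorem forall_dLast_eq_zero_iff (hG : ContDiff ℝ ∞ G) (hν : ContDiffAt ℝ ∞ ν z₀)
    (hn : ContDiffAt ℝ ∞ n z₀) (hδ : ContDiffAt ℝ ∞ δ z₀)
    (h : ∀ᶠ z in 𝓝 z₀, fderiv ℝ G z (ν z) = δ z • n z) (hν0 : ν z₀ ≠ 0)
    (hn0 : δ z₀ = 0 → n z₀ ∉ Set.range (fderiv ℝ G z₀))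
    (hinj : δ z₀ ≠ 0 → Function.Injective (fderiv ℝ G z₀)) (k : ℕ) :
    (∀ i < k, dLast A.μ (i + 1) (A.α z₀) = 0) ↔ ∀ i < k, (along ν)^[i] δ z₀ = 0 := by
  by_cases hδ0 : δ z₀ = 0
  · exact smoothGerms.forall_eq_zero_iff_of_initialIdeal_eq
      (A.initialIdeal_dLast_eq hG hν hn hδ h hν0 (hn0 hδ0) hδ0 k)
  · obtain rfl | hk := k.eq_zero_or_pos
    · simp
    · exact iff_of_false (fun h0 => A.dLast_one_ne_zero hG A.mem_source (hinj hδ0) (h0 0 hk))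
        fun h0 => hδ0 (h0 0 hk)

end KernelField

theorem surjective_fderiv_dLast_comp_iff (hG : ContDiff ℝ ∞ G) (k : ℕ) :
    Function.Surjective (fderiv ℝ (fun z (i : Fin k) => dLast A.μ (i + 1) (A.α z)) z₀) ↔
      Function.Surjective
        (fderiv ℝ (fun (p : X × ℝ) (i : Fin k) => dLast A.μ (i + 1) p) (A.α z₀)) := by
  have hdiff : DifferentiableAt ℝ (fun (p : X × ℝ) (i : Fin k) => dLast A.μ (i + 1) p)
      (A.α z₀) := differentiableAt_pi.2 fun i => A.differentiableAt_dLast hG (i + 1) A.mem_source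
  have hcomp := (hdiff.hasFDerivAt.comp z₀
    ((A.contDiffAt_α A.mem_source).differentiableAt (by simp)).hasFDerivAt).fderiv
  rw [← Function.Surjective.of_comp_iff _ (A.bijective_fderiv_α A.mem_source).surjective,
    ← ContinuousLinearMap.coe_comp, ← hcomp]
  rfl

end AdaptedCoordinates

theorem forall_one_le_iff {P : ℕ → Prop} {k : ℕ} :
    (∀ i, 1 ≤ i → i ≤ k → P i) ↔ ∀ i < k, P (i + 1) :=
  ⟨fun h i hi => h (i + 1) (by omega) hi, fun h i h1 hi => by
    simpa [Nat.sub_add_cancel h1] using h (i - 1) (by omega)⟩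

/-- The vector field `ν` spans the kernel of `DG` along the critical set `δ = 0`. -/
theorem isMorinSingularity_iff_along [CompleteSpace X] {G : Z₁ → Z₂} {z₀ : Z₁}
    (A : AdaptedCoordinates G z₀ X) (hG : ContDiff ℝ ∞ G) {ν : Z₁ → Z₁} {n : Z₁ → Z₂}
    {δ : Z₁ → ℝ} (hν : ContDiffAt ℝ ∞ ν z₀) (hn : ContDiffAt ℝ ∞ n z₀)
    (hδ : ContDiffAt ℝ ∞ δ z₀) (h : ∀ᶠ z in 𝓝 z₀, fderiv ℝ G z (ν z) = δ z • n z)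
    (hν0 : ν z₀ ≠ 0) (hδ0 : δ z₀ = 0) (hn0 : n z₀ ∉ Set.range (fderiv ℝ G z₀))
    (hF : (fderiv ℝ G z₀).IsFredholm) (hker : Module.finrank ℝ (fderiv ℝ G z₀).ker = 1)
    (hcoker : Module.finrank ℝ (Z₂ ⧸ (fderiv ℝ G z₀).range) = 1) (k : ℕ) :
    IsMorinSingularity G k z₀ ↔
      (∀ i < k, (along ν)^[i] δ z₀ = 0) ∧ (along ν)^[k] δ z₀ ≠ 0 ∧
      Function.Surjective (fderiv ℝ (fun z (i : Fin (k - 1)) => (along ν)^[i] δ z) z₀) := by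
  have key {X : Type u} [NormedAddCommGroup X] [NormedSpace ℝ X]
      (A : AdaptedCoordinates G z₀ X) :
      ((∀ i, 1 ≤ i → i ≤ k → dLast A.μ i (A.α z₀) = 0) ∧ dLast A.μ (k + 1) (A.α z₀) ≠ 0 ∧
        Function.Surjective
          (fderiv ℝ (fun (p : X × ℝ) (i : Fin (k - 1)) => dLast A.μ (i + 1) p) (A.α z₀))) ↔
      (∀ i < k, (along ν)^[i] δ z₀ = 0) ∧ (along ν)^[k] δ z₀ ≠ 0 ∧
        Function.Surjective (fderiv ℝ (fun z (i : Fin (k - 1)) => (along ν)^[i] δ z) z₀) := by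
    have hzero := A.forall_dLast_eq_zero_iff hG hν hn hδ h hν0 (fun _ => hn0) (absurd hδ0)
    rw [forall_one_le_iff, hzero k, ← A.surjective_fderiv_dLast_comp_iff hG]
    refine and_congr_right fun hk => and_congr (not_congr ?_) ?_
    · have hk' := hzero (k + 1)
      rw [Nat.forall_lt_succ_right, Nat.forall_lt_succ_right, hzero k] at hk'
      exact and_congr_right_iff.1 hk' hk
    · exact smoothGerms.surjective_fderiv_iff_of_initialIdeal_eq
        (A.initialIdeal_dLast_eq hG hν hn hδ h hν0 hn0 hδ0 (k - 1))
        fun i hi => hk i (by omega)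
  constructor
  · rintro ⟨-, -, -, -, X', _, _, _, A', hA'⟩
    exact (key A').1 hA'
  · exact fun hk => ⟨hG, hF, hker, hcoker, X, _, _, ‹_›, A, (key A).2 hk⟩

end Adapted

/-! ### Rank one perturbations of isomorphisms -/

section RankOne

variable {E F : Type*} [NormedAddCommGroup E] [NormedSpace ℝ E]
  [NormedAddCommGroup F] [NormedSpace ℝ F] (T : E ≃L[ℝ] F) (a : E →L[ℝ] ℝ) (b : F)

open scoped LinearMap.FiniteRangeSetoid in
theorem isFredholm_add_smulRight : ((T : E →L[ℝ] F) + a.smulRight b).IsFredholm := by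
  refine .of_isQuasiInverse (v := (T.symm : F →L[ℝ] E)) <|
    T.toLinearEquiv.isQuasiInverse.congr (Setoid.refl _)
      (LinearMap.FiniteRangeSetoid.equiv_iff_hasNoetherianRange.2 ?_)
  have hrank_one : (((T : E →L[ℝ] F) + a.smulRight b : E →L[ℝ] F) : E →ₗ[ℝ] F) - T.toLinearEquiv =
      (LinearMap.toSpanSingleton ℝ F b).comp (a : E →ₗ[ℝ] ℝ) :=
    LinearMap.ext fun h => by simp
  rw [hrank_one]
  have hb : (LinearMap.toSpanSingleton ℝ F b).HasNoetherianRange := .of_isNoetherian_dom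
  exact hb.comp_right _

variable {T a b}

theorem eq_smul_of_add_smulRight_eq_zero {h : E} (hh : ((T : E →L[ℝ] F) + a.smulRight b) h = 0) :
    h = a h • -T.symm b := by
  have hT : T h = -(a h • b) := eq_neg_of_add_eq_zero_left hh
  rw [smul_neg, ← map_smul, ← map_neg, ← hT, T.symm_apply_apply]

theorem apply_symm_eq_neg_one {h₀ : E} (hne : h₀ ≠ 0)
    (h0 : ((T : E →L[ℝ] F) + a.smulRight b) h₀ = 0) : a (T.symm b) = -1 := by
  have heq := eq_smul_of_add_smulRight_eq_zero h0
  have ha : a h₀ ≠ 0 := fun ha => hne (by rw [heq, ha, zero_smul])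
  have hmul : a h₀ * 1 = a h₀ * -a (T.symm b) := by
    conv_lhs => rw [mul_one, heq, map_smul, map_neg, smul_eq_mul]
  linarith [mul_left_cancel₀ ha hmul]

theorem finrank_ker_add_smulRight (hab : a (T.symm b) = -1) :
    Module.finrank ℝ ((T : E →L[ℝ] F) + a.smulRight b).ker = 1 := by
  have hmem : ((T : E →L[ℝ] F) + a.smulRight b) (-T.symm b) = 0 := by simp [hab]
  have hne : -T.symm b ≠ 0 := fun h => by simp [neg_eq_zero.1 h] at hab
  exact finrank_eq_one_iff'.2 ⟨⟨-T.symm b, hmem⟩, fun h => hne (congrArg Subtype.val h),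
    fun ⟨h, hh⟩ => ⟨a h, Subtype.ext (eq_smul_of_add_smulRight_eq_zero hh).symm⟩⟩

theorem range_add_smulRight (hab : a (T.symm b) = -1) :
    ((T : E →L[ℝ] F) + a.smulRight b).range = (a.comp (T.symm : F →L[ℝ] E)).ker := by
  ext v
  refine ⟨?_, fun hv => ⟨T.symm v, ?_⟩⟩
  · rintro ⟨h, rfl⟩
    simp [hab]
  · have hv : a (T.symm v) = 0 := hv
    simp [hv]

theorem finrank_quotient_range_add_smulRight (hab : a (T.symm b) = -1) :
    Module.finrank ℝ (F ⧸ ((T : E →L[ℝ] F) + a.smulRight b).range) = 1 := by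
  rw [range_add_smulRight hab]
  have hsurj : Function.Surjective (a.comp (T.symm : F →L[ℝ] E) : F →ₗ[ℝ] ℝ) :=
    fun c => ⟨-c • b, by simp [hab]⟩
  exact (LinearMap.quotKerEquivOfSurjective _ hsurj).finrank_eq.trans (Module.finrank_self ℝ)

end RankOne

/-! ### Averages and periodic primitives -/

section Primitive

theorem continuous_coe (x : C0) : Continuous fun t : ℝ => x (t : UnitAddCircle) :=
  x.continuous.comp (AddCircle.continuous_mk' 1)

theorem periodic_coe (x : C0) : Function.Periodic (fun t : ℝ => x (t : UnitAddCircle)) 1 :=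
  fun t => by simp

theorem intervalIntegrable_coe (x : C0) (a b : ℝ) :
    IntervalIntegrable (fun t : ℝ => x (t : UnitAddCircle)) volume a b :=
  (continuous_coe x).intervalIntegrable a b

theorem C0.ext_Icc {x y : C0} (h : ∀ t ∈ Set.Icc (0 : ℝ) 1, x (t : UnitAddCircle) = y t) :
    x = y := by
  ext t
  obtain ⟨s, hs, rfl⟩ := (AddCircle.coe_image_Icc_eq (1 : ℝ) 0).symm ▸ Set.mem_univ t
  exact h s (by simpa using hs)

theorem integral_circle_eq (x : UnitAddCircle → ℝ) :
    ∫ t, x t = ∫ t in (0 : ℝ)..1, x (t : UnitAddCircle) := by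
  simpa using (UnitAddCircle.intervalIntegral_preimage 0 x).symm

/-- The inclusion of `C⁰(𝕊¹)` in `L²(𝕊¹)`. -/
abbrev toL2 : C0 →L[ℝ] L2 := ContinuousMap.toLp 2 volume ℝ

theorem integral_toL2 (x : C0) {t : ℝ} (ht : t ∈ Set.Icc (0 : ℝ) 1) :
    ∫ s in (0 : ℝ)..t, toL2 x (s : UnitAddCircle) = ∫ s in (0 : ℝ)..t, x (s : UnitAddCircle) :=
  integral_L2_congr ht (ae_Ioc_of_ae (ContinuousMap.coeFn_toLp volume x))

/-- The average of a square integrable function on the circle. -/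
def meanL2 : L2 →L[ℝ] ℝ := innerSL ℝ (toL2 1)

theorem meanL2_eq_integral (v : L2) : meanL2 v = ∫ t, v t := by
  rw [meanL2, innerSL_apply_apply, L2.inner_def]
  refine integral_congr_ae ?_
  filter_upwards [ContinuousMap.coeFn_toLp (p := 2) (𝕜 := ℝ) volume (1 : C0)] with t ht
  rw [ht, ContinuousMap.one_apply, real_inner_eq_re_inner, RCLike.inner_apply]
  simp

/-- The average of a continuous function on the circle. -/
def mean : C0 →L[ℝ] ℝ := meanL2.comp toL2

theorem mean_eq_integral (x : C0) : mean x = ∫ t, x t :=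
  (meanL2_eq_integral _).trans (integral_congr_ae (ContinuousMap.coeFn_toLp volume x))

theorem mean_eq (x : C0) : mean x = ∫ t in (0 : ℝ)..1, x (t : UnitAddCircle) :=
  (mean_eq_integral x).trans (integral_circle_eq x)

@[simp]
theorem mean_one : mean 1 = 1 := by
  simp [mean_eq]

theorem norm_meanL2_le (v : L2) : ‖meanL2 v‖ ≤ ‖v‖ := by
  have hone : ‖toL2 1‖ = 1 := by
    rw [← sq_eq_sq₀ (norm_nonneg _) zero_le_one, ← real_inner_self_eq_norm_sq, one_pow]
    exact mean_one
  simpa [meanL2, hone] using norm_inner_le_norm (𝕜 := ℝ) (toL2 1) v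

theorem norm_integral_L2_le (v : L2) {t : ℝ} (ht : t ∈ Set.Icc (0 : ℝ) 1) :
    ‖∫ s in (0 : ℝ)..t, v (s : UnitAddCircle)‖ ≤ ‖v‖ := by
  have habs : ∫ s in (0 : ℝ)..1, ‖v (s : UnitAddCircle)‖ = meanL2 |v| := by
    rw [meanL2_eq_integral, integral_circle_eq]
    exact (integral_L2_congr (by simp) (ae_Ioc_of_ae (Lp.coeFn_abs v))).symm
  calc ‖∫ s in (0 : ℝ)..t, v (s : UnitAddCircle)‖
      ≤ ∫ s in (0 : ℝ)..t, ‖v (s : UnitAddCircle)‖ :=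
        intervalIntegral.norm_integral_le_integral_norm ht.1
    _ ≤ ∫ s in (0 : ℝ)..1, ‖v (s : UnitAddCircle)‖ :=
        intervalIntegral.integral_mono_interval le_rfl ht.1 ht.2
          (.of_forall fun _ => norm_nonneg _) (intervalIntegrable_L2 v (by simp)).norm
    _ ≤ ‖v‖ := by
        rw [habs, ← norm_abs_eq_norm v]
        exact (le_abs_self _).trans (norm_meanL2_le _)

theorem meanL2_toL2 (x : C0) : meanL2 (toL2 x) = mean x := rfl

/-- The periodic primitive of `v - v̄` which vanishes at `0`, for `v` in `L²(𝕊¹)`. -/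
def basedPrimitive (v : L2) : C0 where
  toFun := AddCircle.liftIco 1 0 fun t =>
    ∫ s in (0 : ℝ)..t, (v - meanL2 v • toL2 1) (s : UnitAddCircle)
  continuous_toFun := by
    refine AddCircle.liftIco_zero_continuous ?_ ?_
    · rw [intervalIntegral.integral_same, ← integral_circle_eq, ← meanL2_eq_integral]
      simp [meanL2_toL2]
    · rw [← Set.uIcc_of_le zero_le_one]
      exact intervalIntegral.continuousOn_primitive_interval'
        (intervalIntegrable_L2 _ (by simp)) (by simp)

theorem basedPrimitive_coe (v : L2) {t : ℝ} (ht : t ∈ Set.Icc (0 : ℝ) 1) :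
    basedPrimitive v (t : UnitAddCircle) =
      ∫ s in (0 : ℝ)..t, (v - meanL2 v • toL2 1) (s : UnitAddCircle) := by
  have hIco {r : ℝ} (hr : r ∈ Set.Ico (0 : ℝ) 1) : basedPrimitive v (r : UnitAddCircle) =
      ∫ s in (0 : ℝ)..r, (v - meanL2 v • toL2 1) (s : UnitAddCircle) :=
    AddCircle.liftIco_zero_coe_apply
      (f := fun t : ℝ => ∫ s in (0 : ℝ)..t, (v - meanL2 v • toL2 1) (s : UnitAddCircle)) hr
  obtain ht1 | rfl := ht.2.lt_or_eq
  · exact hIco ⟨ht.1, ht1⟩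
  · rw [← integral_circle_eq, ← meanL2_eq_integral, map_sub, map_smul, meanL2_toL2, mean_one,
      smul_eq_mul, mul_one, sub_self, AddCircle.coe_period, ← QuotientAddGroup.mk_zero]
    exact (hIco (by simp)).trans intervalIntegral.integral_same

theorem basedPrimitive_mem_H1 (v : L2) : (basedPrimitive v, v - meanL2 v • toL2 1) ∈ H1 := by
  intro t ht
  rw [basedPrimitive_coe v ht, basedPrimitive_coe v (by simp), intervalIntegral.integral_same,
    zero_add]

theorem meanL2_of_mem_H1 {u : C0} {v : L2} (h : (u, v) ∈ H1) : meanL2 v = 0 := by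
  have h1 := h 1 (by simp)
  rw [AddCircle.coe_period, QuotientAddGroup.mk_zero, left_eq_add] at h1
  rw [meanL2_eq_integral, integral_circle_eq, h1]

theorem eq_of_mem_H1 {u u' : C0} {v : L2} (h : (u, v) ∈ H1) (h' : (u', v) ∈ H1) :
    u - mean u • 1 = u' - mean u' • 1 := by
  have hconst : u - u' = (u 0 - u' 0) • (1 : C0) := C0.ext_Icc fun t ht => by
    have h1 := h t ht
    have h1' := h' t ht
    simp only at h1 h1'
    simp [h1, h1']
  have hmean := congrArg mean hconst
  rw [map_sub, map_smul, mean_one, smul_eq_mul, mul_one] at hmean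
  rw [← hmean] at hconst
  linear_combination hconst + (sub_smul (mean u) (mean u') (1 : C0))

theorem norm_toL2_le (x : C0) : ‖toL2 x‖ ≤ ‖x‖ := by
  refine (ContinuousLinearMap.le_of_opNorm_le _ (ContinuousMap.toLp_norm_le volume) x).trans ?_
  simp [measureUnivNNReal]

theorem norm_basedPrimitive_le (v : L2) : ‖basedPrimitive v‖ ≤ 2 * ‖v‖ := by
  refine (ContinuousMap.norm_le _ (by positivity)).2 fun t => ?_
  obtain ⟨s, hs, rfl⟩ := (AddCircle.coe_image_Icc_eq (1 : ℝ) 0).symm ▸ Set.mem_univ t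
  rw [zero_add] at hs
  rw [basedPrimitive_coe v hs]
  calc ‖∫ r in (0 : ℝ)..s, (v - meanL2 v • toL2 1) (r : UnitAddCircle)‖
      ≤ ‖v - meanL2 v • toL2 1‖ := norm_integral_L2_le _ hs
    _ ≤ ‖v‖ + ‖meanL2 v‖ * ‖toL2 1‖ := (norm_sub_le _ _).trans_eq (by rw [norm_smul])
    _ ≤ ‖v‖ + ‖v‖ * 1 := by
        gcongr
        · exact norm_meanL2_le v
        · exact (norm_toL2_le 1).trans_eq norm_one
    _ = 2 * ‖v‖ := by ring

/-- The periodic primitive of `v - v̄` with average zero, for `v` in `L²(𝕊¹)`. -/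
def primitiveL2 : L2 →L[ℝ] C0 :=
  LinearMap.mkContinuous
    { toFun := fun v => basedPrimitive v - mean (basedPrimitive v) • 1
      map_add' := fun v w => by
        have h := H1.add_mem (basedPrimitive_mem_H1 v) (basedPrimitive_mem_H1 w)
        rw [Prod.mk_add_mk, ← add_sub_add_comm, ← add_smul, ← map_add] at h
        rw [eq_of_mem_H1 (basedPrimitive_mem_H1 (v + w)) h, map_add]
        module
      map_smul' := fun c v => by
        have h := H1.smul_mem c (basedPrimitive_mem_H1 v)
        rw [Prod.smul_mk, smul_sub, smul_smul, ← smul_eq_mul, ← map_smul meanL2] at h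
        rw [eq_of_mem_H1 (basedPrimitive_mem_H1 (c • v)) h, map_smul]
        simp only [RingHom.id_apply]
        module } 4 fun v => by
    have hmean : ‖mean (basedPrimitive v)‖ ≤ ‖basedPrimitive v‖ :=
      (norm_meanL2_le _).trans (norm_toL2_le _)
    calc ‖basedPrimitive v - mean (basedPrimitive v) • (1 : C0)‖
        ≤ ‖basedPrimitive v‖ + ‖mean (basedPrimitive v)‖ * ‖(1 : C0)‖ :=
          (norm_sub_le _ _).trans_eq (by rw [norm_smul])
      _ ≤ 2 * ‖v‖ + 2 * ‖v‖ * 1 := by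
          rw [norm_one]
          gcongr
          exacts [norm_basedPrimitive_le v, hmean.trans (norm_basedPrimitive_le v)]
      _ = 4 * ‖v‖ := by ring

theorem primitiveL2_apply (v : L2) :
    primitiveL2 v = basedPrimitive v - mean (basedPrimitive v) • 1 := rfl

theorem mean_primitiveL2 (v : L2) : mean (primitiveL2 v) = 0 := by
  simp [primitiveL2_apply]

theorem smul_one_mem_H1 (c : ℝ) : (c • 1, 0) ∈ H1 := by
  intro t _
  simp

theorem primitiveL2_mem_H1 (v : L2) : (primitiveL2 v, v - meanL2 v • toL2 1) ∈ H1 := by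
  simpa [primitiveL2_apply, sub_eq_add_neg] using
    H1.add_mem (basedPrimitive_mem_H1 v) (H1.neg_mem (smul_one_mem_H1 (mean (basedPrimitive v))))

theorem primitiveL2_of_mem_H1 {u : C0} {v : L2} (h : (u, v) ∈ H1) :
    primitiveL2 v = u - mean u • 1 := by
  have hv := primitiveL2_mem_H1 v
  rw [meanL2_of_mem_H1 h, zero_smul, sub_zero] at hv
  simpa [mean_primitiveL2] using eq_of_mem_H1 hv h

theorem sub_meanL2_mem_H1 (v : L2) :
    (primitiveL2 v + meanL2 v • 1, v - meanL2 v • toL2 1) ∈ H1 := by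
  simpa using add_mem (primitiveL2_mem_H1 v) (smul_one_mem_H1 (meanL2 v))

theorem mem_C1_iff_mem_H1 {u x : C0} : (u, x) ∈ C1 ↔ (u, toL2 x) ∈ H1 := by
  refine ⟨fun h t ht => ?_, fun h => ?_⟩
  · rw [integral_toL2 x ht, intervalIntegral.integral_eq_sub_of_hasDerivAt (fun s _ => h s)
      (intervalIntegrable_coe x 0 t)]
    ring
  · have hmean : ∫ s in (0 : ℝ)..1, x (s : UnitAddCircle) = 0 := by
      rw [← mean_eq, ← meanL2_toL2, meanL2_of_mem_H1 h]
    have hint (t : ℝ) : u (t : UnitAddCircle) = u ((0 : ℝ) : UnitAddCircle) +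
        ∫ s in (0 : ℝ)..t, x (s : UnitAddCircle) := by
      have hper : Function.Periodic (fun t : ℝ => u (t : UnitAddCircle) -
          ∫ s in (0 : ℝ)..t, x (s : UnitAddCircle)) 1 := fun t => by
        have hadd := intervalIntegral.integral_add_adjacent_intervals
          (intervalIntegrable_coe x 0 t) (intervalIntegrable_coe x t (t + 1))
        rw [(periodic_coe x).intervalIntegral_add_eq t 0, zero_add, hmean, add_zero] at hadd
        simp [hadd]
      obtain ⟨s, hs, hst⟩ := hper.exists_mem_Ico₀ one_pos t
      have hs' := h s ⟨hs.1, hs.2.le⟩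
      rw [integral_toL2 x ⟨hs.1, hs.2.le⟩] at hs'
      simp only at hst hs'
      linarith
    intro t
    rw [funext hint]
    exact ((continuous_coe x).integral_hasStrictDerivAt 0 t).hasDerivAt.const_add _

/-- The periodic primitive of `x - x̄` with average zero. -/
def primitive : C0 →L[ℝ] C0 := primitiveL2.comp toL2

theorem mean_primitive (x : C0) : mean (primitive x) = 0 := mean_primitiveL2 _

theorem primitive_mem_C1 (x : C0) : (primitive x, x - mean x • 1) ∈ C1 := by
  rw [mem_C1_iff_mem_H1, map_sub, map_smul]
  exact primitiveL2_mem_H1 (toL2 x)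

theorem neg_primitive_mem_C1 (x : C0) : (-primitive x, mean x • 1 - x) ∈ C1 := by
  simpa using neg_mem (primitive_mem_C1 x)

theorem mean_of_mem_C1 {u x : C0} (h : (u, x) ∈ C1) : mean x = 0 :=
  meanL2_of_mem_H1 (mem_C1_iff_mem_H1.1 h)

theorem primitive_of_mem_C1 {u x : C0} (h : (u, x) ∈ C1) : primitive x = u - mean u • 1 :=
  primitiveL2_of_mem_H1 (mem_C1_iff_mem_H1.1 h)

theorem smul_one_mem_C1 (c : ℝ) : (c • 1, 0) ∈ C1 := by
  simpa [mem_C1_iff_mem_H1] using smul_one_mem_H1 c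

@[simp]
theorem primitive_one : primitive 1 = 0 := by
  have h := primitive_mem_C1 1
  rw [mean_one, one_smul, sub_self] at h
  simpa [mean_primitive] using (primitive_of_mem_C1 h).symm

theorem mul_mem_C1 {u x v y : C0} (hu : (u, x) ∈ C1) (hv : (v, y) ∈ C1) :
    (u * v, x * v + u * y) ∈ C1 := fun t => (hu t).mul (hv t)

theorem primitive_mul_self_mem_C1 (x : C0) : (primitive x * primitive x,
    (2 : ℝ) • (x * primitive x - mean x • primitive x)) ∈ C1 := by
  convert! mul_mem_C1 (primitive_mem_C1 x) (primitive_mem_C1 x) using 2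
  rw [mul_comm (primitive x), sub_mul, smul_mul_assoc, one_mul]
  module

theorem mean_mul_primitive_self (x : C0) : mean (x * primitive x) = 0 := by
  simpa [mean_primitive] using mean_of_mem_C1 (primitive_mul_self_mem_C1 x)

theorem primitive_mul_primitive_self (x : C0) : primitive (x * primitive x) =
    (1 / 2 : ℝ) • (primitive x ^ 2 - mean (primitive x ^ 2) • 1) +
      mean x • primitive (primitive x) := by
  have h := primitive_of_mem_C1 (primitive_mul_self_mem_C1 x)
  rw [← sq, map_smul, map_sub, map_smul] at h
  rw [← h]
  module

theorem exp_coe (x : C0) (t : UnitAddCircle) : NormedSpace.exp x t = Real.exp (x t) := by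
  rw [Real.exp_eq_exp_ℝ]
  exact NormedSpace.map_exp (ContinuousMap.evalAlgHom ℝ ℝ t) (continuous_eval_const t) x

theorem exp_mem_C1 {u x : C0} (h : (u, x) ∈ C1) :
    (NormedSpace.exp u, x * NormedSpace.exp u) ∈ C1 := fun t => by
  convert! (h t).exp using 1
  · exact funext fun s => exp_coe u s
  · simp [exp_coe, mul_comm]

/-- The projection `x ↦ x - x̄` to the functions of average zero. -/
def center : C0 →L[ℝ] C0 := ContinuousLinearMap.id ℝ C0 - mean.smulRight 1

theorem center_apply (x : C0) : center x = x - mean x • 1 := rfl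

theorem mean_center (x : C0) : mean (center x) = 0 := by
  simp [center_apply]

theorem primitive_center (x : C0) : primitive (center x) = primitive x := by
  simp [center_apply]

theorem center_mem_C1 (x : C0) : (primitive x + mean x • 1, center x) ∈ C1 := by
  simpa [center_apply] using add_mem (primitive_mem_C1 x) (smul_one_mem_C1 (mean x))

theorem periodic_green : Function.Periodic green 1 := fun s => by
  simp only [green, Int.floor_add_one]
  push_cast
  ring

theorem integral_centered_mul (x : C0) (t : ℝ) :
    ∫ s in t..t + 1, (s - t - 1 / 2) * x (s : UnitAddCircle) = primitive x (t : UnitAddCircle) := by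
  have hcont : Continuous fun s : ℝ => (s - t - 1 / 2) * x (s : UnitAddCircle) :=
    Continuous.mul (by fun_prop) (continuous_coe x)
  have hP := continuous_coe (primitive x)
  have hderiv (s : ℝ) : HasDerivAt
      (fun s : ℝ => (s - t - 1 / 2) * primitive x (s : UnitAddCircle) +
        mean x * (s - t - 1 / 2) ^ 2 / 2)
      (primitive x (s : UnitAddCircle) + (s - t - 1 / 2) * x (s : UnitAddCircle)) s := by
    have hlin : HasDerivAt (fun s => s - t - 1 / 2) 1 s :=
      ((hasDerivAt_id s).sub_const t).sub_const _
    convert! (hlin.mul (primitive_mem_C1 x s)).add (((hlin.pow 2).const_mul (mean x)).div_const 2)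
      using 1
    simp only [one_div, one_mul, ContinuousMap.sub_apply, ContinuousMap.coe_smul,
      ContinuousMap.coe_one, Pi.smul_apply, Pi.one_apply, smul_eq_mul, mul_one, Nat.cast_ofNat,
      Nat.add_one_sub_one, pow_one]
    ring
  have hftc := intervalIntegral.integral_eq_sub_of_hasDerivAt (fun s _ => hderiv s)
    ((hP.add hcont).intervalIntegrable t (t + 1))
  rw [intervalIntegral.integral_add (hP.intervalIntegrable _ _) (hcont.intervalIntegrable _ _),
    (periodic_coe (primitive x)).intervalIntegral_add_eq t 0, zero_add, ← mean_eq,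
    mean_primitive, zero_add] at hftc
  have hend : primitive x ((t + 1 : ℝ) : UnitAddCircle) = primitive x t :=
    periodic_coe (primitive x) t
  rw [hftc, hend]
  ring

theorem integral_green_mul (x : C0) (t : ℝ) :
    ∫ s in (0 : ℝ)..1, green (s - t) * x (s : UnitAddCircle) = primitive x (t : UnitAddCircle) := by
  have hper : Function.Periodic (fun s : ℝ => green (s - t) * x (s : UnitAddCircle)) 1 :=
    (periodic_green.sub_const t).mul (periodic_coe x)
  have hgreen : Set.EqOn (fun s : ℝ => (s - t - 1 / 2) * x (s : UnitAddCircle))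
      (fun s : ℝ => green (s - t) * x (s : UnitAddCircle)) (Set.Ioo t (t + 1)) := fun s hs => by
    have hfloor : ⌊s - t⌋ = 0 := Int.floor_eq_zero_iff.2 ⟨by linarith [hs.1], by linarith [hs.2]⟩
    simp [green, hfloor]
  have hshift := hper.intervalIntegral_add_eq 0 t
  rw [zero_add] at hshift
  rw [hshift, ← intervalIntegral.integral_congr_Ioo_of_le (by linarith) hgreen,
    integral_centered_mul]

end Primitive

/-! ### Substitution operators -/

section Substitution

variable {f : UnitAddCircle → ℝ → ℝ} (hf : IsSmooth f)

theorem IsSmooth.iteratedDeriv (hf : IsSmooth f) (j : ℕ) :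
    IsSmooth fun t => iteratedDeriv j (f t) :=
  contDiffOn_univ.1 (contDiffOn_dLast (X := ℝ) isOpen_univ (contDiffOn_univ.2 hf) j)

theorem IsSmooth.hasDerivAt_iteratedDeriv (hf : IsSmooth f) (j : ℕ) (t : UnitAddCircle) (y : ℝ) :
    HasDerivAt (_root_.iteratedDeriv j (f t)) (_root_.iteratedDeriv (j + 1) (f t) y) y := by
  obtain ⟨s, rfl⟩ := QuotientAddGroup.mk_surjective t
  have hsection : ContDiff ℝ ∞ fun y : ℝ => _root_.iteratedDeriv j (f s) y :=
    ContDiff.comp (hf.iteratedDeriv j)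
      (contDiff_const.prodMk contDiff_id : ContDiff ℝ ∞ fun y : ℝ => (s, y))
  rw [iteratedDeriv_succ]
  exact (hsection.differentiable (by simp) y).hasDerivAt

theorem continuous_substitute : Continuous (substitute f hf) :=
  ContinuousMap.continuous_of_continuous_uncurry _ <|
    hf.continuous.comp (continuous_snd.prodMk continuous_eval)

/-- The Nemytskii operator `u ↦ D₂ʲf(·, u(·))` on `C⁰(𝕊¹)`. -/
def nemytskii (j : ℕ) : C0 → C0 :=
  substitute (fun t => iteratedDeriv j (f t)) (hf.iteratedDeriv j)

theorem nemytskii_apply (j : ℕ) (u : C0) (t : UnitAddCircle) :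
    nemytskii hf j u t = iteratedDeriv j (f t) (u t) := rfl

theorem nemytskii_coe (j : ℕ) (u : C0) (t : ℝ) :
    nemytskii hf j u (t : UnitAddCircle) = D2 f j u t := rfl

theorem nemytskii_zero : nemytskii hf 0 = substitute f hf := by
  ext u t
  simp [nemytskii_apply, substitute]

theorem norm_nemytskii_add_sub_le {j : ℕ} {u h : C0} {ε : ℝ}
    (hε : ∀ s ∈ Set.Icc (0 : ℝ) 1,
      ‖nemytskii hf (j + 1) (u + s • h) - nemytskii hf (j + 1) u‖ ≤ ε) :
    ‖nemytskii hf j (u + h) - nemytskii hf j u - nemytskii hf (j + 1) u * h‖ ≤ ε * ‖h‖ := by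
  have hε0 : 0 ≤ ε := (norm_nonneg _).trans (hε 0 (by simp))
  refine (ContinuousMap.norm_le _ (by positivity)).2 fun t => ?_
  let φ (s : ℝ) : ℝ := iteratedDeriv j (f t) (u t + s * h t) - s * (nemytskii hf (j + 1) u t * h t)
  have hφ (s : ℝ) : HasDerivAt φ
      ((nemytskii hf (j + 1) (u + s • h) - nemytskii hf (j + 1) u) t * h t) s := by
    have hline : HasDerivAt (fun s : ℝ => u t + s * h t) (h t) s := by
      simpa using ((hasDerivAt_id s).mul_const (h t)).const_add (u t)
    convert! ((hf.hasDerivAt_iteratedDeriv j t _).comp s hline).sub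
      ((hasDerivAt_id s).mul_const (nemytskii hf (j + 1) u t * h t)) using 1
    simp [nemytskii_apply, sub_mul]
  have hbound : ‖φ 1 - φ 0‖ ≤ ε * ‖h‖ :=
    norm_image_sub_le_of_norm_deriv_le_segment_01' (fun s _ => (hφ s).hasDerivWithinAt)
      fun s hs => by
        rw [norm_mul]
        gcongr
        · exact (ContinuousMap.norm_coe_le_norm _ t).trans (hε s ⟨hs.1, hs.2.le⟩)
        · exact h.norm_coe_le_norm t
  convert! hbound using 2
  simp only [ContinuousMap.sub_apply, nemytskii_apply, ContinuousMap.add_apply,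
    ContinuousMap.mul_apply, one_mul, zero_mul, add_zero, sub_zero, φ]
  ring

theorem hasFDerivAt_nemytskii (j : ℕ) (u : C0) : HasFDerivAt (nemytskii hf j)
    (ContinuousLinearMap.mul ℝ C0 (nemytskii hf (j + 1) u)) u := by
  rw [hasFDerivAt_iff_isLittleO_nhds_zero, Asymptotics.isLittleO_iff]
  intro ε hε
  obtain ⟨δ, hδ, hball⟩ := Metric.continuousAt_iff.1
    (continuous_substitute (hf.iteratedDeriv (j + 1))).continuousAt ε hε
  filter_upwards [Metric.ball_mem_nhds (0 : C0) hδ] with h hh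
  refine norm_nemytskii_add_sub_le hf fun s hs => ?_
  rw [← dist_eq_norm]
  refine (hball ?_).le
  rw [dist_eq_norm, add_sub_cancel_left, norm_smul, Real.norm_of_nonneg hs.1]
  exact (mul_le_of_le_one_left (norm_nonneg _) hs.2).trans_lt (mem_ball_zero_iff.1 hh)

theorem contDiff_nemytskii (j : ℕ) : ContDiff ℝ ∞ (nemytskii hf j) := by
  rw [contDiff_infty]
  intro n
  induction n generalizing j with
  | zero => exact contDiff_zero.2 (continuous_substitute _)
  | succ n ih =>
    exact_mod_cast contDiff_succ_iff_hasFDerivAt.2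
      ⟨_, (ContinuousLinearMap.contDiff _).comp (ih (j + 1)), hasFDerivAt_nemytskii hf j⟩

end Substitution

/-! ### The functionals `Σ₁, …, Σ₅` -/

section Functionals

variable {f : UnitAddCircle → ℝ → ℝ} (hf : IsSmooth f)

/-- The positive periodic function `w_u = exp (-P(D₂f(t, u)))`, where `P` is the mean zero
primitive. It spans the kernel of `h ↦ h' + D₂f(t, u) h` when `Σ₁(u) = 0`. -/
def kernelFn (u : C0) : C0 := NormedSpace.exp (-primitive (nemytskii hf 1 u))

/-- The mean zero periodic primitive of `D₂²f(t, u) w_u - c`, where `c = Σ₂(u)` is its average. When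
`Σ₂(u) = 0`, it differs from the function `A` of the statement by a constant. -/
def kernelPrimitive (u : C0) : C0 := primitive (nemytskii hf 2 u * kernelFn hf u)

local notation "𝐍" => nemytskii hf
local notation "𝐖" => kernelFn hf
local notation "𝐕" => kernelPrimitive hf

theorem kernelFn_pos (u : C0) (t : UnitAddCircle) : 0 < 𝐖 u t := by
  rw [kernelFn, exp_coe]
  exact Real.exp_pos _

theorem kernelFn_mem_C1 (u : C0) : (𝐖 u, mean (𝐍 1 u) • 𝐖 u - 𝐍 1 u * 𝐖 u) ∈ C1 := by
  convert! exp_mem_C1 (neg_primitive_mem_C1 (𝐍 1 u)) using 2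
  rw [sub_mul, smul_mul_assoc, one_mul, kernelFn]

theorem contDiff_kernelFn : ContDiff ℝ ∞ 𝐖 :=
  (contDiff_iff_contDiffAt.2 fun x => (NormedSpace.exp_analytic (𝕂 := ℝ) x).contDiffAt).comp
    (primitive.contDiff.comp (contDiff_nemytskii hf 1)).neg

theorem contDiff_kernelPrimitive : ContDiff ℝ ∞ 𝐕 :=
  primitive.contDiff.comp ((contDiff_nemytskii hf 2).mul (contDiff_kernelFn hf))

theorem kerVec_eq (u : C0) (t : ℝ) : kerVec f u t = 𝐖 u (t : UnitAddCircle) := by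
  rw [kernelFn, exp_coe, ContinuousMap.neg_apply, ← integral_green_mul]
  rfl

theorem primitiveW_eq (u : C0) (t : ℝ) :
    primitiveW f u t = 𝐕 u (t : UnitAddCircle) - 𝐕 u 0 + t * mean (𝐍 2 u * 𝐖 u) := by
  have hderiv (s : ℝ) : HasDerivAt
      (fun s : ℝ => 𝐕 u (s : UnitAddCircle) + s * mean (𝐍 2 u * 𝐖 u))
      (D2 f 2 u s * kerVec f u s) s := by
    convert! (primitive_mem_C1 (𝐍 2 u * 𝐖 u) s).add
      ((hasDerivAt_id s).mul_const (mean (𝐍 2 u * 𝐖 u))) using 1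
    simp [kerVec_eq hf, nemytskii_coe]
  have hcont : Continuous fun s : ℝ => D2 f 2 u s * kerVec f u s := by
    simp only [kerVec_eq hf]
    exact continuous_coe (𝐍 2 u * 𝐖 u)
  rw [primitiveW, intervalIntegral.integral_eq_sub_of_hasDerivAt (fun s _ => hderiv s)
    (hcont.intervalIntegrable _ _)]
  simp only [QuotientAddGroup.mk_zero, zero_mul, add_zero]
  ring

theorem fderiv_nemytskii (j : ℕ) (u h : C0) : fderiv ℝ (𝐍 j) u h = 𝐍 (j + 1) u * h := by
  rw [(hasFDerivAt_nemytskii hf j u).fderiv]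
  rfl

theorem fderiv_kernelFn (u : C0) : fderiv ℝ 𝐖 u (𝐖 u) = -(𝐖 u * 𝐕 u) := by
  have hexp := (hasFDerivAt_exp (𝕂 := ℝ)).comp u
    (primitive.hasFDerivAt.comp u (hasFDerivAt_nemytskii hf 1 u)).neg
  rw [HasFDerivAt.fderiv (f := 𝐖) hexp]
  simp [kernelFn, kernelPrimitive]

theorem differentiable_nemytskii (j : ℕ) : Differentiable ℝ (𝐍 j) :=
  (contDiff_nemytskii hf j).differentiable (by simp)

theorem differentiable_kernelFn : Differentiable ℝ 𝐖 :=
  (contDiff_kernelFn hf).differentiable (by simp)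

theorem differentiable_kernelPrimitive : Differentiable ℝ 𝐕 :=
  (contDiff_kernelPrimitive hf).differentiable (by simp)

theorem fderiv_nemytskii_mul_kernelFn_pow (j n : ℕ) (u : C0) :
    fderiv ℝ (fun u => 𝐍 j u * 𝐖 u ^ n) u (𝐖 u) =
      𝐍 (j + 1) u * 𝐖 u ^ (n + 1) - (n : ℝ) • (𝐍 j u * 𝐖 u ^ n * 𝐕 u) := by
  have hW := differentiable_kernelFn hf u
  rw [fderiv_fun_mul (differentiable_nemytskii hf j u) (hW.fun_pow n), fderiv_fun_pow n hW]
  rcases n with _ | n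
  · simp [fderiv_nemytskii]
  · ext t
    simp only [add_tsub_cancel_right, nsmul_eq_mul, Nat.cast_add, Nat.cast_one, add_apply,
      smul_apply, fderiv_kernelFn, smul_eq_mul, mul_neg, fderiv_nemytskii, ContinuousMap.add_apply,
      ContinuousMap.neg_apply, ContinuousMap.mul_apply, ContinuousMap.natCast_apply,
      ContinuousMap.one_apply, ContinuousMap.pow_apply, ContinuousMap.sub_apply,
      ContinuousMap.coe_smul, ContinuousMap.coe_mul, ContinuousMap.coe_pow, Pi.smul_apply,
      Pi.mul_apply, Pi.pow_apply]
    ring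

theorem differentiable_nemytskii_mul_kernelFn_pow (j n : ℕ) :
    Differentiable ℝ fun u => 𝐍 j u * 𝐖 u ^ n :=
  (differentiable_nemytskii hf j).mul ((differentiable_kernelFn hf).pow n)

theorem fderiv_clm_comp_apply {Z E F : Type*} [NormedAddCommGroup Z] [NormedSpace ℝ Z]
    [NormedAddCommGroup E] [NormedSpace ℝ E] [NormedAddCommGroup F] [NormedSpace ℝ F]
    (L : E →L[ℝ] F) {g : Z → E} {z : Z} (hg : DifferentiableAt ℝ g z) (h : Z) :
    fderiv ℝ (fun z => L (g z)) z h = L (fderiv ℝ g z h) :=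
  congrArg (· h) (L.hasFDerivAt.comp z hg.hasFDerivAt).fderiv

theorem fderiv_kernelPrimitive (u : C0) : fderiv ℝ 𝐕 u (𝐖 u) =
    primitive (𝐍 3 u * 𝐖 u ^ 2) - primitive (𝐍 2 u * 𝐖 u * 𝐕 u) := by
  have h := fderiv_clm_comp_apply primitive
    (differentiable_nemytskii_mul_kernelFn_pow hf 2 1 u) (𝐖 u)
  rw [fderiv_nemytskii_mul_kernelFn_pow, map_sub, Nat.cast_one, one_smul] at h
  simp only [pow_one] at h
  exact h

theorem integral_eq_mean {g : ℝ → ℝ} {x : C0} (h : ∀ t : ℝ, g t = x (t : UnitAddCircle)) :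
    ∫ t in (0 : ℝ)..1, g t = mean x := by
  rw [mean_eq, funext h]

theorem Sig_one (u : C0) : Sig f 1 u = mean (𝐍 1 u) := integral_eq_mean fun _ => rfl

theorem Sig_two (u : C0) : Sig f 2 u = mean (𝐍 2 u * 𝐖 u ^ 1) :=
  integral_eq_mean fun t => by simp [kerVec_eq hf, nemytskii_coe]

theorem Sig_three (u : C0) : Sig f 3 u = mean (𝐍 3 u * 𝐖 u ^ 2) :=
  integral_eq_mean fun t => by simp [kerVec_eq hf, nemytskii_coe]

/-- The functional `Σ₄` with `A` replaced by `kernelPrimitive`; it is the third derivative of `Σ₁`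
along the vector field `w`. -/
def centeredSigFour (u : C0) : ℝ :=
  mean (𝐍 4 u * 𝐖 u ^ 3 - (2 : ℝ) • (𝐍 3 u * 𝐖 u ^ 2 * 𝐕 u))

/-- The functional `Σ₅` with `A` replaced by `kernelPrimitive`. -/
def centeredSigFive (u : C0) : ℝ :=
  mean (𝐍 5 u * 𝐖 u ^ 4 - (5 : ℝ) • (𝐍 4 u * 𝐖 u ^ 3 * 𝐕 u)
    + (5 : ℝ) • (𝐍 3 u * 𝐖 u ^ 2 * 𝐕 u ^ 2))

theorem Sig_four {u : C0} (h : Sig f 2 u = 0) :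
    Sig f 4 u = centeredSigFour hf u + 2 * 𝐕 u 0 * Sig f 3 u := by
  rw [Sig_two hf, pow_one] at h
  have hmean : centeredSigFour hf u + 2 * 𝐕 u 0 * Sig f 3 u =
      mean (𝐍 4 u * 𝐖 u ^ 3 - (2 : ℝ) • (𝐍 3 u * 𝐖 u ^ 2 * 𝐕 u)
        + (2 * 𝐕 u 0) • (𝐍 3 u * 𝐖 u ^ 2)) := by
    rw [map_add, map_smul, smul_eq_mul, Sig_three hf, centeredSigFour]
  rw [hmean]
  refine integral_eq_mean fun t => ?_
  simp only [← nemytskii_coe hf, kerVec_eq hf, primitiveW_eq hf, h, mul_zero, add_zero,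
    ContinuousMap.add_apply, ContinuousMap.sub_apply, ContinuousMap.mul_apply,
    ContinuousMap.pow_apply, ContinuousMap.coe_smul, ContinuousMap.coe_mul, ContinuousMap.coe_pow,
    Pi.smul_apply, Pi.mul_apply, Pi.pow_apply, smul_eq_mul]
  ring

theorem Sig_five {u : C0} (h : Sig f 2 u = 0) :
    Sig f 5 u = centeredSigFive hf u + 5 * 𝐕 u 0 * centeredSigFour hf u +
      5 * 𝐕 u 0 ^ 2 * Sig f 3 u := by
  rw [Sig_two hf, pow_one] at h
  have hmean : centeredSigFive hf u + 5 * 𝐕 u 0 * centeredSigFour hf u +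
      5 * 𝐕 u 0 ^ 2 * Sig f 3 u =
      mean (𝐍 5 u * 𝐖 u ^ 4 - (5 : ℝ) • (𝐍 4 u * 𝐖 u ^ 3 * 𝐕 u)
        + (5 : ℝ) • (𝐍 3 u * 𝐖 u ^ 2 * 𝐕 u ^ 2)
        + (5 * 𝐕 u 0) • (𝐍 4 u * 𝐖 u ^ 3 - (2 : ℝ) • (𝐍 3 u * 𝐖 u ^ 2 * 𝐕 u))
        + (5 * 𝐕 u 0 ^ 2) • (𝐍 3 u * 𝐖 u ^ 2)) := by
    rw [map_add, map_add, map_smul, map_smul, smul_eq_mul, smul_eq_mul, Sig_three hf,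
      centeredSigFour, centeredSigFive]
  rw [hmean]
  refine integral_eq_mean fun t => ?_
  simp only [← nemytskii_coe hf, kerVec_eq hf, primitiveW_eq hf, h, mul_zero, add_zero,
    ContinuousMap.add_apply, ContinuousMap.sub_apply, ContinuousMap.mul_apply,
    ContinuousMap.pow_apply, ContinuousMap.coe_smul, ContinuousMap.coe_mul, ContinuousMap.coe_pow,
    Pi.smul_apply, Pi.mul_apply, Pi.pow_apply, smul_eq_mul, ContinuousMap.coe_sub, Pi.sub_apply]
  ring

theorem along_Sig_one : along 𝐖 (Sig f 1) = Sig f 2 := by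
  ext u
  rw [funext (Sig_one hf), Sig_two hf, along,
    fderiv_clm_comp_apply mean (differentiable_nemytskii hf 1 u), fderiv_nemytskii, pow_one]

theorem along_Sig_two : along 𝐖 (Sig f 2) = Sig f 3 := by
  ext u
  have hmean : mean (𝐍 2 u * 𝐖 u * 𝐕 u) = 0 := mean_mul_primitive_self _
  rw [funext (Sig_two hf), Sig_three hf, along, fderiv_clm_comp_apply mean
    (differentiable_nemytskii_mul_kernelFn_pow hf 2 1 u), fderiv_nemytskii_mul_kernelFn_pow]
  simp [hmean]

theorem along_Sig_three : along 𝐖 (Sig f 3) = centeredSigFour hf := by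
  ext u
  rw [funext (Sig_three hf), centeredSigFour, along, fderiv_clm_comp_apply mean
    (differentiable_nemytskii_mul_kernelFn_pow hf 3 2 u), fderiv_nemytskii_mul_kernelFn_pow]
  norm_num

theorem along_centeredSigFour (u : C0) : along 𝐖 (centeredSigFour hf) u =
    centeredSigFive hf u - mean (𝐕 u ^ 2) * Sig f 3 u +
      2 * Sig f 2 u * mean (𝐍 3 u * 𝐖 u ^ 2 * primitive (𝐕 u)) := by
  have hd := differentiable_nemytskii_mul_kernelFn_pow hf
  have hV := differentiable_kernelPrimitive hf u
  have hd3 := (hd 3 2 u).fun_mul hV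
  have hprim : primitive (𝐍 2 u * 𝐖 u * 𝐕 u) =
      (1 / 2 : ℝ) • (𝐕 u ^ 2 - mean (𝐕 u ^ 2) • 1) + Sig f 2 u • primitive (𝐕 u) := by
    rw [Sig_two hf, pow_one]
    exact primitive_mul_primitive_self _
  have hmean := mean_mul_primitive_self (𝐍 3 u * 𝐖 u ^ 2)
  have hderiv : fderiv ℝ (fun u => 𝐍 4 u * 𝐖 u ^ 3 - (2 : ℝ) • (𝐍 3 u * 𝐖 u ^ 2 * 𝐕 u)) u (𝐖 u) =
      (𝐍 5 u * 𝐖 u ^ 4 - (5 : ℝ) • (𝐍 4 u * 𝐖 u ^ 3 * 𝐕 u)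
        + (5 : ℝ) • (𝐍 3 u * 𝐖 u ^ 2 * 𝐕 u ^ 2))
      - mean (𝐕 u ^ 2) • (𝐍 3 u * 𝐖 u ^ 2)
      + (2 * Sig f 2 u) • (𝐍 3 u * 𝐖 u ^ 2 * primitive (𝐕 u))
      - (2 : ℝ) • (𝐍 3 u * 𝐖 u ^ 2 * primitive (𝐍 3 u * 𝐖 u ^ 2)) := by
    rw [fderiv_fun_sub (hd 4 3 u) (hd3.fun_const_smul (2 : ℝ)), fderiv_fun_const_smul hd3,
      fderiv_fun_mul (hd 3 2 u) hV]
    simp only [sub_apply, smul_apply, add_apply, fderiv_nemytskii_mul_kernelFn_pow,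
      fderiv_kernelPrimitive, hprim]
    ext t
    simp only [Nat.reduceAdd, Nat.cast_ofNat, one_div, smul_eq_mul, smul_add,
      ContinuousMap.sub_apply, ContinuousMap.mul_apply, ContinuousMap.pow_apply,
      ContinuousMap.coe_smul, ContinuousMap.coe_mul, ContinuousMap.coe_pow, Pi.smul_apply,
      Pi.mul_apply, Pi.pow_apply, ContinuousMap.add_apply, ContinuousMap.coe_sub,
      ContinuousMap.coe_add, ContinuousMap.coe_one, Pi.sub_apply, Pi.add_apply, Pi.one_apply,
      mul_one]
    ring
  have hcomp : along 𝐖 (centeredSigFour hf) u = mean _ := fderiv_clm_comp_apply mean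
    ((hd 4 3 u).fun_sub (hd3.fun_const_smul (2 : ℝ))) (𝐖 u)
  rw [hcomp, hderiv, Sig_three hf, centeredSigFive]
  simp only [map_sub, map_add, map_smul, smul_eq_mul, hmean]
  ring

theorem contDiff_Sig_one (hf : IsSmooth f) : ContDiff ℝ ∞ (Sig f 1) := by
  rw [funext (Sig_one hf)]
  exact mean.contDiff.comp (contDiff_nemytskii hf 1)

theorem iterate_along_Sig_one {i : ℕ} (hi : i < 3) :
    (along 𝐖)^[i] (Sig f 1) = Sig f (i + 1) := by
  interval_cases i
  · rfl
  · exact along_Sig_one hf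
  · rw [Function.iterate_succ_apply', Function.iterate_one, along_Sig_one, along_Sig_two]

theorem iterate_along_Sig_one_apply {i : ℕ} (hi : i < 5) {u : C0}
    (h : ∀ j, 1 ≤ j → j ≤ i → Sig f j u = 0) :
    (along 𝐖)^[i] (Sig f 1) u = Sig f (i + 1) u := by
  have hthree : (along 𝐖)^[3] (Sig f 1) = centeredSigFour hf := by
    rw [Function.iterate_succ_apply', iterate_along_Sig_one hf (by norm_num), along_Sig_three]
  obtain hi | rfl | rfl : i < 3 ∨ i = 3 ∨ i = 4 := by omega
  · rw [iterate_along_Sig_one hf hi]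
  · have h₂ := h 2 (by norm_num) (by norm_num)
    rw [hthree, Sig_four hf h₂, h 3 (by norm_num) le_rfl, mul_zero, add_zero]
  · have h₂ := h 2 (by norm_num) (by norm_num)
    have h₃ := h 3 (by norm_num) (by norm_num)
    have h₄ : centeredSigFour hf u = 0 := by
      simpa [Sig_four hf h₂, h₃] using h 4 (by norm_num) le_rfl
    rw [Function.iterate_succ_apply', hthree, along_centeredSigFour, Sig_five hf h₂, h₂, h₃, h₄]
    ring

theorem forall_iterate_along_Sig_one_eq_zero_iff {k : ℕ} (hk : k ≤ 5) (u : C0) :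
    (∀ i < k, (along 𝐖)^[i] (Sig f 1) u = 0) ↔ ∀ i, 1 ≤ i → i ≤ k → Sig f i u = 0 := by
  refine ⟨fun h i => ?_, fun h i hi => ?_⟩
  · induction i using Nat.strong_induction_on with
    | _ i ih =>
      intro h₁ hik
      obtain ⟨i, rfl⟩ := Nat.exists_eq_add_of_le' h₁
      rw [← iterate_along_Sig_one_apply hf (by omega) fun j hj hji =>
        ih j (by omega) hj (by omega)]
      exact h i (by omega)
  · rw [iterate_along_Sig_one_apply hf (by omega) fun j hj hji => h j hj (by omega)]
    exact h (i + 1) (by omega) (by omega)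

end Functionals

/-! ### The linear equation `z' + g z = r` on the circle -/

section Linear

theorem lipschitzWith_of_mem_C1 {u x : C0} (h : (u, x) ∈ C1) : LipschitzWith ‖x‖₊ u := by
  refine LipschitzWith.of_dist_le_mul fun s t => ?_
  obtain ⟨a, rfl⟩ := QuotientAddGroup.mk_surjective s
  obtain ⟨b, rfl⟩ := QuotientAddGroup.mk_surjective t
  have hperiodic : u (a : UnitAddCircle) = u ((a - round (a - b) : ℝ) : UnitAddCircle) := by
    simpa using ((periodic_coe u).sub_int_mul_eq (round (a - b))).symm
  have hmvt := convex_univ.norm_image_sub_le_of_norm_hasDerivWithin_le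
    (fun r _ => (h r).hasDerivWithinAt) (fun r _ => x.norm_coe_le_norm _)
    (Set.mem_univ b) (Set.mem_univ (a - round (a - b)))
  calc dist (u (a : UnitAddCircle)) (u (b : UnitAddCircle))
      = ‖u ((a - round (a - b) : ℝ) : UnitAddCircle) - u (b : UnitAddCircle)‖ := by
        rw [dist_eq_norm, hperiodic]
    _ ≤ ‖x‖ * ‖a - round (a - b) - b‖ := hmvt
    _ = ‖x‖₊ * dist (a : UnitAddCircle) (b : UnitAddCircle) := by
        rw [dist_eq_norm (a : UnitAddCircle), ← AddCircle.coe_sub, UnitAddCircle.norm_eq,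
          coe_nnnorm, Real.norm_eq_abs, sub_right_comm]

open scoped NNReal in
theorem isCompact_lipschitzWith_bounded (K : ℝ≥0) (C : ℝ) :
    IsCompact {u : C0 | LipschitzWith K u ∧ ∀ t, u t ∈ Set.Icc (-C) C} := by
  refine ArzelaAscoli.isCompact_of_equicontinuous _ ?_
    (LipschitzWith.uniformEquicontinuous _ K fun u => u.2.1).equicontinuous
  have himage : ContinuousMap.toFun '' {u : C0 | LipschitzWith K u ∧ ∀ t, u t ∈ Set.Icc (-C) C} =
      {u | LipschitzWith K u} ∩ Set.univ.pi fun _ => Set.Icc (-C) C := by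
    ext u
    refine ⟨?_, fun hu => ⟨⟨u, hu.1.continuous⟩, ⟨hu.1, fun t => hu.2 t trivial⟩, rfl⟩⟩
    rintro ⟨u, hu, rfl⟩
    exact ⟨hu.1, fun t _ => hu.2 t⟩
  rw [himage]
  exact (isCompact_univ_pi fun _ => isCompact_Icc).inter_left (isClosed_setOfPred_lipschitzWith K)

theorem isCompactOperator_primitive : IsCompactOperator primitive := by
  refine (isCompactOperator_iff_image_closedBall_subset_compact (𝕜₁ := ℝ) (𝕜₂ := ℝ)
    (primitive : C0 →ₗ[ℝ] C0) zero_lt_one).2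
    ⟨_, isCompact_lipschitzWith_bounded 2 ‖primitive‖, ?_⟩
  rintro _ ⟨x, hx, rfl⟩
  have hx : ‖x‖ ≤ 1 := mem_closedBall_zero_iff.1 hx
  have hderiv : ‖x - mean x • 1‖ ≤ 2 := by
    have hmean : ‖mean x‖ ≤ 1 := (norm_meanL2_le _).trans ((norm_toL2_le x).trans hx)
    calc ‖x - mean x • (1 : C0)‖ ≤ ‖x‖ + ‖mean x‖ * ‖(1 : C0)‖ :=
          (norm_sub_le _ _).trans_eq (congrArg _ (norm_smul _ _))
      _ ≤ 2 := by rw [norm_one]; linarith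
  refine ⟨(lipschitzWith_of_mem_C1 (primitive_mem_C1 x)).weaken hderiv, fun t => abs_le.1 ?_⟩
  exact ((primitive x).norm_coe_le_norm t).trans (primitive.unit_le_opNorm x hx)

theorem exists_eq_zero_of_mean_eq_zero {x : C0} (hx : mean x = 0) :
    ∃ t : ℝ, x (t : UnitAddCircle) = 0 := by
  obtain ⟨t, -, ht⟩ := exists_hasDerivAt_eq_zero (zero_lt_one (α := ℝ))
    (continuous_coe (primitive x)).continuousOn (by simpa using (periodic_coe (primitive x) 0).symm)
    fun t _ => primitive_mem_C1 x t
  exact ⟨t, by simpa [hx] using ht⟩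

/-- Multiplied by the (non periodic) integrating factor `exp ∫ g`, `z` has derivative
`c exp ∫ g`, and it vanishes at `t₀` and `t₀ + 1`: by Rolle's theorem `c = 0`. -/
theorem eq_zero_of_mean_eq_zero {z g : C0} {c : ℝ} (hz : (z, c • 1 - g * z) ∈ C1)
    (hmean : mean z = 0) : z = 0 := by
  obtain ⟨t₀, ht₀⟩ := exists_eq_zero_of_mean_eq_zero hmean
  have ht₁ : z ((t₀ + 1 : ℝ) : UnitAddCircle) = 0 := (periodic_coe z t₀).trans ht₀
  let m (t : ℝ) : ℝ := Real.exp (primitive g (t : UnitAddCircle) + t * mean g)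
  have hm (t : ℝ) : m t ≠ 0 := (Real.exp_pos _).ne'
  have hderiv (t : ℝ) : HasDerivAt (fun s : ℝ => m s * z (s : UnitAddCircle)) (m t * c) t := by
    convert! ((primitive_mem_C1 g t).add ((hasDerivAt_id t).mul_const (mean g))).exp.mul
      (hz t) using 1
    simp only [id_eq, Pi.add_apply, ContinuousMap.sub_apply, ContinuousMap.coe_smul,
      ContinuousMap.coe_one, Pi.smul_apply, Pi.one_apply, smul_eq_mul, mul_one, one_mul,
      sub_add_cancel, ContinuousMap.mul_apply, m]
    ring
  have hc : c = 0 := by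
    obtain ⟨t, -, ht⟩ := exists_hasDerivAt_eq_zero (lt_add_one t₀)
      (fun t _ => (hderiv t).continuousAt.continuousWithinAt)
      (by rw [ht₀, ht₁, mul_zero, mul_zero]) fun t _ => hderiv t
    exact (mul_eq_zero.1 ht).resolve_left (hm t)
  refine C0.ext_Icc fun t _ => (mul_eq_zero.1 ?_).resolve_left (hm t)
  have hconst := is_const_of_deriv_eq_zero (fun t => (hderiv t).differentiableAt)
    (fun t => by rw [(hderiv t).deriv, hc, mul_zero]) t t₀
  simpa [ht₀] using hconst

theorem mul_exp_primitive_mem_C1 {y g r : C0} (hy : (y, r - g * y) ∈ C1) :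
    (y * NormedSpace.exp (primitive g),
      r * NormedSpace.exp (primitive g) - mean g • (y * NormedSpace.exp (primitive g))) ∈ C1 := by
  convert! mul_mem_C1 hy (exp_mem_C1 (primitive_mem_C1 g)) using 2
  rw [sub_mul (g : C0), smul_mul_assoc, one_mul, sub_mul, mul_sub, mul_smul_comm]
  ring

theorem eq_zero_of_mean_ne_zero {y g : C0} (hy : (y, -(g * y)) ∈ C1) (hg : mean g ≠ 0) :
    y = 0 := by
  rw [← zero_sub] at hy
  have hz := mul_exp_primitive_mem_C1 hy
  rw [zero_mul] at hz
  have hmean : mean (y * NormedSpace.exp (primitive g)) = 0 := by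
    simpa [hg] using mean_of_mem_C1 hz
  have hzero := eq_zero_of_mean_eq_zero (c := 0) (g := mean g • 1) (by simpa using hz) hmean
  ext t
  have ht := congrArg (fun x : C0 => x t) hzero
  rw [ContinuousMap.mul_apply, exp_coe] at ht
  exact (mul_eq_zero.1 ht).resolve_right (Real.exp_pos _).ne'

theorem notMem_C1_of_mean_eq_zero {y g : C0} (hg : mean g = 0) :
    (y, NormedSpace.exp (-primitive g) - g * y) ∉ C1 := fun hy => by
  have hmean := mean_of_mem_C1 (mul_exp_primitive_mem_C1 hy)
  have hone : NormedSpace.exp (-primitive g) * NormedSpace.exp (primitive g) = 1 := by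
    ext t
    simp [exp_coe, ← Real.exp_add]
  rw [hone, hg, zero_smul, sub_zero, mean_one] at hmean
  exact one_ne_zero hmean

/-- By the Fredholm alternative, since `y ↦ P(g y)` is compact. -/
theorem bijective_add_primitive_mul (g : C0) :
    Function.Bijective fun y : C0 => y + primitive (g * y) := by
  let T : C0 →L[ℝ] C0 := -primitive.comp (ContinuousLinearMap.mul ℝ C0 g)
  have hT : IsCompactOperator T :=
    (isCompactOperator_primitive.comp_clm (ContinuousLinearMap.mul ℝ C0 g)).neg
  have heq : (fun y : C0 => y + primitive (g * y)) = algebraMap ℝ (C0 →L[ℝ] C0) 1 - T := by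
    ext y : 1
    simp [T]
  rw [heq]
  refine ContinuousLinearMap.isUnit_iff_bijective.1
    ((hT.hasEigenvalue_or_mem_resolventSet one_ne_zero).resolve_left fun heigen => ?_)
  obtain ⟨y, hy⟩ := heigen.exists_hasEigenvector
  have hy_eq : -primitive (g * y) = y := by simpa [T] using hy.apply_eq_smul
  have hmem := neg_primitive_mem_C1 (g * y)
  rw [hy_eq] at hmem
  exact hy.2 (eq_zero_of_mean_eq_zero hmem (by rw [← hy_eq, map_neg, mean_primitive, neg_zero]))

/-- The function `g` is the average of `D₂f` over the segment from `v` to `u`. -/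
theorem exists_substitute_sub_eq {f : UnitAddCircle → ℝ → ℝ} (hf : IsSmooth f) (u v : C0) :
    ∃ g : C0, substitute f hf u - substitute f hf v = g * (u - v) := by
  refine ⟨∫ s in (0 : ℝ)..1, nemytskii hf 1 (v + s • (u - v)), ?_⟩
  have hline (s : ℝ) : HasDerivAt (fun s : ℝ => v + s • (u - v)) (u - v) s := by
    simpa using ((hasDerivAt_id s).smul_const (u - v)).const_add v
  have hderiv (s : ℝ) : HasDerivAt (fun s : ℝ => nemytskii hf 0 (v + s • (u - v)))
      (nemytskii hf 1 (v + s • (u - v)) * (u - v)) s :=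
    (hasFDerivAt_nemytskii hf 0 _).comp_hasDerivAt s (hline s)
  have hcont : Continuous fun s : ℝ => nemytskii hf 1 (v + s • (u - v)) :=
    (contDiff_nemytskii hf 1).continuous.comp (by fun_prop)
  have hftc := intervalIntegral.integral_eq_sub_of_hasDerivAt (a := 0) (b := 1)
    (fun s _ => hderiv s) ((hcont.mul continuous_const).intervalIntegrable _ _)
  have hmul := ((ContinuousLinearMap.mul ℝ C0).flip (u - v)).intervalIntegral_comp_comm
    (hcont.intervalIntegrable (μ := volume) 0 1)
  simp only [ContinuousLinearMap.flip_apply, ContinuousLinearMap.mul_apply'] at hmul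
  rw [← hmul, hftc, nemytskii_zero]
  simp

end Linear

/-! ### The operator `u ↦ u' + f(t, u)` -/

/-- Banach spaces `B₁` and `B₀` of functions on the circle with `B₁ ⊆ C⁰ ⊆ B₀` and `B₁` the space of
primitives of elements of `B₀`, so that `C¹ ⊆ B₁`. It covers both `(C¹, C⁰)` and `(H¹, L²)`. -/
structure DerivPair (B₁ B₀ : Type) [NormedAddCommGroup B₁] [NormedSpace ℝ B₁]
    [NormedAddCommGroup B₀] [NormedSpace ℝ B₀] where
  /-- the inclusion `B₁ ⊆ C⁰` -/
  ι : B₁ →L[ℝ] C0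
  /-- the derivative -/
  d : B₁ →L[ℝ] B₀
  /-- the inclusion `C⁰ ⊆ B₀` -/
  e : C0 →L[ℝ] B₀
  /-- the average -/
  avg : B₀ →L[ℝ] ℝ
  /-- the isomorphism `u ↦ u' + ū` -/
  equiv : B₁ ≃L[ℝ] B₀
  avg_e : ∀ x, avg (e x) = mean x
  avg_d : ∀ u, avg (d u) = 0
  equiv_apply : ∀ u, equiv u = d u + mean (ι u) • e 1
  ι_equiv_symm_e : ∀ x, ι (equiv.symm (e x)) = primitive x + mean x • 1

namespace DerivPair

variable {B₁ B₀ : Type} [NormedAddCommGroup B₁] [NormedSpace ℝ B₁]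
  [NormedAddCommGroup B₀] [NormedSpace ℝ B₀] (m : DerivPair B₁ B₀)

theorem avg_one : m.avg (m.e 1) = 1 := by
  rw [m.avg_e, mean_one]

theorem avg_equiv (u : B₁) : m.avg (m.equiv u) = mean (m.ι u) := by
  simp [m.equiv_apply, m.avg_d, m.avg_one]

theorem mem_C1_of_d_eq {u : B₁} {x : C0} (hd : m.d u = m.e x) : (m.ι u, x) ∈ C1 := by
  have hmean : mean x = 0 := by rw [← m.avg_e, ← hd, m.avg_d]
  have hu : u = m.equiv.symm (m.e (x + mean (m.ι u) • 1)) := by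
    rw [ContinuousLinearEquiv.eq_symm_apply, m.equiv_apply, hd, map_add, map_smul]
  have hι : m.ι u = primitive x + mean (m.ι u) • 1 := by
    conv_lhs => rw [hu]
    simp [m.ι_equiv_symm_e, hmean]
  rw [hι]
  simpa [hmean] using add_mem (primitive_mem_C1 x) (smul_one_mem_C1 (mean (m.ι u)))

theorem eq_zero_of_ι_eq_zero {u : B₁} {x : C0} (hd : m.d u = m.e x) (hu : m.ι u = 0) : u = 0 := by
  have hmem := m.mem_C1_of_d_eq hd
  rw [hu] at hmem
  have hx : x = 0 := C0.ext_Icc fun t _ => (hmem t).unique (hasDerivAt_const t (0 : ℝ))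
  rw [← m.equiv.map_eq_zero_iff, m.equiv_apply, hd, hx, hu]
  simp

theorem completeSpace (m : DerivPair B₁ B₀) [CompleteSpace B₀] : CompleteSpace B₁ :=
  (completeSpace_congr (e := m.equiv.toLinearEquiv.toEquiv) m.equiv.isUniformEmbedding).2 ‹_›

section Operator

variable {f : UnitAddCircle → ℝ → ℝ} (hf : IsSmooth f)

/-- The operator `F(u) = u' + f(t, u)`. -/
def op (u : B₁) : B₀ := m.d u + m.e (substitute f hf (m.ι u))

theorem contDiff_op : ContDiff ℝ ∞ (m.op hf) := by
  have hsub := contDiff_nemytskii hf 0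
  rw [nemytskii_zero] at hsub
  exact m.d.contDiff.add (m.e.contDiff.comp (hsub.comp m.ι.contDiff))

theorem fderiv_op_apply (u h : B₁) :
    fderiv ℝ (m.op hf) u h = m.d h + m.e (nemytskii hf 1 (m.ι u) * m.ι h) := by
  have hsub := hasFDerivAt_nemytskii hf 0 (m.ι u)
  rw [nemytskii_zero] at hsub
  have hop := m.d.hasFDerivAt.add (m.e.hasFDerivAt.comp u (hsub.comp u m.ι.hasFDerivAt))
  exact congrArg (· h) hop.fderiv

theorem fderiv_op_injective {u : B₁} (hu : Sig f 1 (m.ι u) ≠ 0) :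
    Function.Injective (fderiv ℝ (m.op hf) u) := by
  refine (injective_iff_map_eq_zero _).2 fun h hh => ?_
  rw [fderiv_op_apply, add_eq_zero_iff_eq_neg, ← map_neg] at hh
  rw [Sig_one hf] at hu
  exact m.eq_zero_of_ι_eq_zero hh (eq_zero_of_mean_ne_zero (m.mem_C1_of_d_eq hh) hu)

theorem notMem_range_fderiv_op {u : B₁} (hu : Sig f 1 (m.ι u) = 0) :
    m.e (kernelFn hf (m.ι u)) ∉ Set.range (fderiv ℝ (m.op hf) u) := by
  rintro ⟨h, hh⟩
  rw [fderiv_op_apply, ← eq_sub_iff_add_eq, ← map_sub] at hh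
  rw [Sig_one hf] at hu
  exact notMem_C1_of_mean_eq_zero hu (m.mem_C1_of_d_eq hh)

/-- The smooth vector field on `B₁` whose value at `u` is the function `w_u`. -/
def kernelField (u : B₁) : B₁ :=
  m.equiv.symm (m.e (mean (nemytskii hf 1 (m.ι u)) • kernelFn hf (m.ι u)
    - nemytskii hf 1 (m.ι u) * kernelFn hf (m.ι u) + mean (kernelFn hf (m.ι u)) • 1))

theorem contDiff_kernelField : ContDiff ℝ ∞ (m.kernelField hf) := by
  have hN := (contDiff_nemytskii hf 1).comp m.ι.contDiff
  have hW := (contDiff_kernelFn hf).comp m.ι.contDiff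
  exact m.equiv.symm.contDiff.comp (m.e.contDiff.comp
    ((((mean.contDiff.comp hN).smul hW).sub (hN.mul hW)).add
      ((mean.contDiff.comp hW).smul contDiff_const)))

theorem ι_kernelField (u : B₁) : m.ι (m.kernelField hf u) = kernelFn hf (m.ι u) := by
  have hW := kernelFn_mem_C1 hf (m.ι u)
  rw [kernelField, m.ι_equiv_symm_e, map_add, primitive_of_mem_C1 hW, map_add, mean_of_mem_C1 hW]
  simp

theorem d_kernelField (u : B₁) : m.d (m.kernelField hf u) =
    m.e (mean (nemytskii hf 1 (m.ι u)) • kernelFn hf (m.ι u)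
      - nemytskii hf 1 (m.ι u) * kernelFn hf (m.ι u)) := by
  have hequiv := m.equiv_apply (m.kernelField hf u)
  have hval : m.equiv (m.kernelField hf u) = m.e (_ + _) := m.equiv.apply_symm_apply _
  rw [ι_kernelField, hval, map_add, map_smul m.e (mean (kernelFn hf (m.ι u))) 1,
    add_left_inj] at hequiv
  exact hequiv.symm

theorem fderiv_op_kernelField (u : B₁) : fderiv ℝ (m.op hf) u (m.kernelField hf u) =
    Sig f 1 (m.ι u) • m.e (kernelFn hf (m.ι u)) := by
  rw [fderiv_op_apply, d_kernelField, ι_kernelField, ← map_add, sub_add_cancel, map_smul,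
    Sig_one hf]

theorem kernelField_ne_zero (u : B₁) : m.kernelField hf u ≠ 0 := by
  intro h
  have hpos := kernelFn_pos hf (m.ι u) 0
  simp [← ι_kernelField, h] at hpos

theorem contDiff_kernelFn_comp : ContDiff ℝ ∞ fun u => m.e (kernelFn hf (m.ι u)) :=
  m.e.contDiff.comp ((contDiff_kernelFn hf).comp m.ι.contDiff)

theorem contDiff_Sig_one_comp (hf : IsSmooth f) : ContDiff ℝ ∞ fun u => Sig f 1 (m.ι u) :=
  (contDiff_Sig_one hf).comp m.ι.contDiff

theorem iterate_along_kernelField (i : ℕ) :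
    (along (m.kernelField hf))^[i] (fun u => Sig f 1 (m.ι u)) =
      fun u => (along (kernelFn hf))^[i] (Sig f 1) (m.ι u) :=
  iterate_along_comp_clm m.ι (m.ι_kernelField hf) (contDiff_kernelFn hf) (contDiff_Sig_one hf) i

theorem forall_iterate_along_kernelField_eq_zero_iff {k : ℕ} (hk : k ≤ 5) (u : B₁) :
    (∀ i < k, (along (m.kernelField hf))^[i] (fun u => Sig f 1 (m.ι u)) u = 0) ↔
      ∀ i, 1 ≤ i → i ≤ k → Sig f i (m.ι u) = 0 := by
  simp only [iterate_along_kernelField]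
  exact forall_iterate_along_Sig_one_eq_zero_iff hf hk (m.ι u)

theorem not_isMorinSingularity {k : ℕ} {u : B₁} (hu : Sig f 1 (m.ι u) ≠ 0) :
    ¬IsMorinSingularity (m.op hf) k u := fun h => by
  have hker : (fderiv ℝ (m.op hf) u).ker = ⊥ :=
    LinearMap.ker_eq_bot.2 (m.fderiv_op_injective hf hu)
  have hdim := h.2.2.1
  rw [hker, finrank_bot] at hdim
  exact zero_ne_one hdim

/-! ### The diffeomorphism `Ψ` -/

/-- The map `Ψ(u) = F(u) - c + ū`, where `c` is the average of `F(u)`. -/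
abbrev psi : B₁ → B₀ := Psi (m.op hf) (fun u => mean (m.ι u)) m.avg (m.e 1)

theorem psi_apply (u : B₁) :
    m.psi hf u = m.equiv u + m.e (center (substitute f hf (m.ι u))) := by
  rw [psi, Psi, op, map_add m.avg, m.avg_d, m.avg_e, m.equiv_apply, center_apply, map_sub m.e,
    map_smul m.e]
  module

theorem avg_psi (u : B₁) : m.avg (m.psi hf u) = mean (m.ι u) := by
  rw [psi_apply, map_add, m.avg_equiv, m.avg_e, mean_center, add_zero]

/-- The derivative of `Ψ` at `u`, where `g(t) = D₂f(t, u(t))`. -/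
def psiDeriv (g : C0) : B₁ →L[ℝ] B₀ :=
  m.equiv + m.e.comp (center.comp ((ContinuousLinearMap.mul ℝ C0 g).comp m.ι))

theorem psiDeriv_apply (g : C0) (h : B₁) :
    m.psiDeriv g h = m.equiv h + m.e (center (g * m.ι h)) := rfl

theorem ι_equiv_symm_center (x : C0) : m.ι (m.equiv.symm (m.e (center x))) = primitive x := by
  rw [m.ι_equiv_symm_e, mean_center, zero_smul, add_zero, primitive_center]

/-- The equation `psiDeriv g h = v` amounts to the integral equation `y + P(g y) = r` for `y = ι h`,
where `P` is the primitive and `r` depends on `v`. -/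
theorem bijective_psiDeriv (g : C0) : Function.Bijective (m.psiDeriv g) := by
  have hbij := bijective_add_primitive_mul g
  constructor
  · refine (injective_iff_map_eq_zero _).2 fun h hh => ?_
    have hsymm : h = -m.equiv.symm (m.e (center (g * m.ι h))) := by
      rw [← map_neg, ContinuousLinearEquiv.eq_symm_apply]
      exact eq_neg_of_add_eq_zero_left hh
    have hι : m.ι h = 0 := hbij.injective <| by
      have := congrArg m.ι hsymm
      rw [map_neg, ι_equiv_symm_center, ← add_eq_zero_iff_eq_neg] at this
      simpa using this
    rw [hsymm, hι]
    simp
  · intro v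
    obtain ⟨y, hy⟩ := hbij.surjective (m.ι (m.equiv.symm v))
    refine ⟨m.equiv.symm (v - m.e (center (g * y))), ?_⟩
    have hι : m.ι (m.equiv.symm (v - m.e (center (g * y)))) = y := by
      rw [map_sub, map_sub, ι_equiv_symm_center, ← hy, add_sub_cancel_right]
    rw [psiDeriv_apply, hι, m.equiv.apply_symm_apply, sub_add_cancel]

theorem psi_injective : Function.Injective (m.psi hf) := by
  intro u v h
  obtain ⟨g, hg⟩ := exists_substitute_sub_eq hf (m.ι u) (m.ι v)
  refine sub_eq_zero.1 ((m.bijective_psiDeriv g).injective ?_)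
  rw [map_zero, psiDeriv_apply, map_sub m.ι, ← hg, map_sub, map_sub, map_sub, ← sub_eq_zero.2 h,
    psi_apply, psi_apply]
  abel

theorem contDiff_psi : ContDiff ℝ ∞ (m.psi hf) := by
  have hsub := contDiff_nemytskii hf 0
  rw [nemytskii_zero] at hsub
  rw [funext (m.psi_apply hf)]
  exact m.equiv.contDiff.add
    (m.e.contDiff.comp (center.contDiff.comp (hsub.comp m.ι.contDiff)))

theorem hasFDerivAt_psi (u : B₁) :
    HasFDerivAt (m.psi hf) (m.psiDeriv (nemytskii hf 1 (m.ι u))) u := by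
  have hsub := hasFDerivAt_nemytskii hf 0 (m.ι u)
  rw [nemytskii_zero] at hsub
  rw [funext (m.psi_apply hf)]
  exact m.equiv.hasFDerivAt.add (m.e.hasFDerivAt.comp u
    (center.hasFDerivAt.comp u (hsub.comp u m.ι.hasFDerivAt)))

/-- The splitting of `B₀` into functions of average zero and constants. -/
def splitting : B₀ ≃L[ℝ] m.avg.ker × ℝ :=
  ContinuousLinearEquiv.equivOfInverse
    (((ContinuousLinearMap.id ℝ B₀ - m.avg.smulRight (m.e 1)).codRestrict m.avg.ker fun v => by
      change m.avg (v - m.avg v • m.e 1) = 0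
      simp [m.avg_one]).prod m.avg)
    (m.avg.ker.subtypeL.comp (ContinuousLinearMap.fst ℝ _ _) +
      (ContinuousLinearMap.snd ℝ _ _).smulRight (m.e 1))
    (fun v => by
      change (v - m.avg v • m.e 1) + m.avg v • m.e 1 = v
      simp)
    (fun p => by
      have havg : m.avg (p.1 : B₀) = 0 := p.1.2
      have havg' : m.avg ((p.1 : B₀) + p.2 • m.e 1) = p.2 := by simp [havg, m.avg_one]
      refine Prod.ext (Subtype.ext ?_) havg'
      change ((p.1 : B₀) + p.2 • m.e 1) - m.avg ((p.1 : B₀) + p.2 • m.e 1) • m.e 1 = p.1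
      rw [havg']
      simp)

theorem splitting_fst (v : B₀) : ((m.splitting v).1 : B₀) = v - m.avg v • m.e 1 := rfl

variable [CompleteSpace B₁] [CompleteSpace B₀]

/-- The derivative of `Ψ` as an isomorphism. -/
def psiDerivEquiv (g : C0) : B₁ ≃L[ℝ] B₀ :=
  ContinuousLinearEquiv.ofBijective (m.psiDeriv g)
    (LinearMap.ker_eq_bot.2 (m.bijective_psiDeriv g).injective)
    (LinearMap.range_eq_top.2 (m.bijective_psiDeriv g).surjective)

theorem hasFDerivAt_psi_equiv (u : B₁) :
    HasFDerivAt (m.psi hf) (m.psiDerivEquiv (nemytskii hf 1 (m.ι u)) : B₁ →L[ℝ] B₀) u := by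
  rw [psiDerivEquiv, ContinuousLinearEquiv.coe_ofBijective]
  exact m.hasFDerivAt_psi hf u

/-- Since `F - Ψ` takes its values in the constants. -/
theorem fderiv_op_eq_add_smulRight (u : B₁) : fderiv ℝ (m.op hf) u =
    (m.psiDerivEquiv (nemytskii hf 1 (m.ι u)) : B₁ →L[ℝ] B₀) +
      (mean.comp ((ContinuousLinearMap.mul ℝ C0 (nemytskii hf 1 (m.ι u))).comp m.ι) -
        mean.comp m.ι).smulRight (m.e 1) := by
  ext h
  rw [fderiv_op_apply, psiDerivEquiv, ContinuousLinearEquiv.coe_ofBijective]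
  simp only [add_apply, psiDeriv_apply, m.equiv_apply, center_apply,
    ContinuousLinearMap.smulRight_apply, sub_apply,
    ContinuousLinearMap.comp_apply, ContinuousLinearMap.mul_apply', map_sub, map_smul]
  module

/-- The restriction of `Ψ` to a neighborhood of `u`. -/
def psiHomeo (u : B₁) : OpenPartialHomeomorph B₁ B₀ :=
  ContDiffAt.toOpenPartialHomeomorph (m.psi hf) (m.contDiff_psi hf).contDiffAt
    (m.hasFDerivAt_psi_equiv hf u) (by simp)

theorem mem_psiHomeo_source (u : B₁) : u ∈ (m.psiHomeo hf u).source :=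
  ContDiffAt.mem_toOpenPartialHomeomorph_source (m.contDiff_psi hf).contDiffAt _ _

theorem contDiffOn_psiHomeo_symm (u : B₁) :
    ContDiffOn ℝ ∞ (m.psiHomeo hf u).symm (m.psiHomeo hf u).target := fun _ hv =>
  ((m.psiHomeo hf u).contDiffAt_symm hv (m.hasFDerivAt_psi_equiv hf _)
    (m.contDiff_psi hf).contDiffAt).contDiffWithinAt

theorem invFun_psi (u : B₁) {v : B₀} (hv : v ∈ (m.psiHomeo hf u).target) :
    Function.invFun (m.psi hf) v = (m.psiHomeo hf u).symm v := by
  have hright : m.psi hf ((m.psiHomeo hf u).symm v) = v := (m.psiHomeo hf u).right_inv hv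
  conv_lhs => rw [← hright]
  exact Function.leftInverse_invFun (m.psi_injective hf) _

/-- The adapted coordinates given by `Ψ`. -/
def coordinates (u : B₁) : AdaptedCoordinates (m.op hf) u m.avg.ker where
  α := (m.psiHomeo hf u).transHomeomorph m.splitting.toHomeomorph
  β := m.splitting.toHomeomorph.toOpenPartialHomeomorph
  mem_source := m.mem_psiHomeo_source hf u
  mapsTo := fun _ _ => Set.mem_univ _
  contDiffOn_α := (m.splitting.contDiff.comp (m.contDiff_psi hf)).contDiffOn
  contDiffOn_α_symm := (m.contDiffOn_psiHomeo_symm hf u).comp m.splitting.symm.contDiff.contDiffOn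
    fun _ hp => hp
  contDiffOn_β := m.splitting.contDiff.contDiffOn
  contDiffOn_β_symm := m.splitting.symm.contDiff.contDiffOn
  fst_eq := fun z _ => by
    refine Subtype.ext ?_
    change ((m.splitting (m.op hf z)).1 : B₀) = ((m.splitting (m.psi hf z)).1 : B₀)
    rw [splitting_fst, splitting_fst, avg_psi, psi, Psi, add_sub_cancel_right]

theorem iteratedDeriv_phi (u : B₁) (i : ℕ) :
    iteratedDeriv i (fun a : ℝ => phi (m.op hf) (fun u => mean (m.ι u)) m.avg (m.e 1)
      (m.psi hf u + a • m.e 1)) 0 =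
    dLast (m.coordinates hf u).μ i ((m.coordinates hf u).α u) := by
  set A := m.coordinates hf u
  have htranslate : dLast A.μ i (A.α u) =
      iteratedDeriv i (fun a : ℝ => A.μ ((A.α u).1, (A.α u).2 + a)) 0 := by
    rw [iteratedDeriv_comp_const_add i (fun y => A.μ ((A.α u).1, y))]
    simp [dLast]
  rw [htranslate]
  refine Filter.EventuallyEq.iteratedDeriv_eq i ?_
  have hcont : ContinuousAt (fun a : ℝ => m.psi hf u + a • m.e 1) 0 := by fun_prop
  have htarget : ∀ᶠ a : ℝ in 𝓝 0, m.psi hf u + a • m.e 1 ∈ (m.psiHomeo hf u).target := by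
    refine hcont.eventually ((m.psiHomeo hf u).open_target.mem_nhds ?_)
    change m.psi hf u + (0 : ℝ) • m.e 1 ∈ _
    rw [zero_smul, add_zero]
    exact (m.psiHomeo hf u).map_source (m.mem_psiHomeo_source hf u)
  filter_upwards [htarget] with a ha
  have hsplit : m.splitting.symm ((A.α u).1, (A.α u).2 + a) = m.psi hf u + a • m.e 1 := by
    change ((m.splitting (m.psi hf u)).1 : B₀) + (m.avg (m.psi hf u) + a) • m.e 1 = _
    rw [splitting_fst, add_smul, ← add_assoc, sub_add_cancel]
  change m.avg (m.op hf (Function.invFun (m.psi hf) _)) =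
    m.avg (m.op hf ((m.psiHomeo hf u).symm (m.splitting.symm ((A.α u).1, (A.α u).2 + a))))
  rw [m.invFun_psi hf u ha, hsplit]

theorem stratum_eq {k : ℕ} (hk : k ≤ 5) :
    stratum (m.op hf) (fun u => mean (m.ι u)) m.avg (m.e 1) k =
      {u : B₁ | ∀ i, 1 ≤ i → i ≤ k → Sig f i (m.ι u) = 0} := by
  ext u
  have hdLast := (m.coordinates hf u).forall_dLast_eq_zero_iff (m.contDiff_op hf)
    (m.contDiff_kernelField hf).contDiffAt (m.contDiff_kernelFn_comp hf).contDiffAt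
    (m.contDiff_Sig_one_comp hf).contDiffAt (.of_forall (m.fderiv_op_kernelField hf))
    (m.kernelField_ne_zero hf u) (m.notMem_range_fderiv_op hf) (m.fderiv_op_injective hf) k
  rw [m.forall_iterate_along_kernelField_eq_zero_iff hf hk] at hdLast
  rw [stratum]
  simp only [iteratedDeriv_phi]
  exact forall_one_le_iff.trans hdLast

theorem isMorinSingularity_iff_of_Sig_one_eq_zero {k : ℕ} (hk : k ≤ 4) {u : B₁}
    (hu : Sig f 1 (m.ι u) = 0) :
    IsMorinSingularity (m.op hf) k u ↔
      (∀ i, 1 ≤ i → i ≤ k → Sig f i (m.ι u) = 0) ∧ Sig f (k + 1) (m.ι u) ≠ 0 ∧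
        Function.Surjective
          (fderiv ℝ (fun (v : B₁) (i : Fin (k - 1)) => Sig f (i + 1) (m.ι v)) u) := by
  have hker := m.fderiv_op_kernelField hf u
  have hDF := m.fderiv_op_eq_add_smulRight hf u
  rw [hu, zero_smul, hDF] at hker
  have hrank := apply_symm_eq_neg_one (m.kernelField_ne_zero hf u) hker
  have : CompleteSpace m.avg.ker := m.avg.isClosed_ker.completeSpace_coe
  rw [isMorinSingularity_iff_along (m.coordinates hf u) (m.contDiff_op hf)
    (m.contDiff_kernelField hf).contDiffAt (m.contDiff_kernelFn_comp hf).contDiffAt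
    (m.contDiff_Sig_one_comp hf).contDiffAt (.of_forall (m.fderiv_op_kernelField hf))
    (m.kernelField_ne_zero hf u) hu (m.notMem_range_fderiv_op hf hu)
    (hDF ▸ isFredholm_add_smulRight _ _ _) (hDF ▸ finrank_ker_add_smulRight hrank)
    (hDF ▸ finrank_quotient_range_add_smulRight hrank),
    m.forall_iterate_along_kernelField_eq_zero_iff hf (by omega)]
  refine and_congr_right fun h => ?_
  have hfun : (fun (v : B₁) (i : Fin (k - 1)) =>
      (along (m.kernelField hf))^[i] (fun u => Sig f 1 (m.ι u)) v) =
      fun v (i : Fin (k - 1)) => Sig f (i + 1) (m.ι v) := by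
    ext v i
    simp only [iterate_along_kernelField]
    rw [iterate_along_Sig_one hf (by omega)]
  rw [hfun, iterate_along_kernelField, ← iterate_along_Sig_one_apply hf (by omega) h]

theorem isMorinSingularity_iff {k : ℕ} (hk1 : 1 ≤ k) (hk : k ≤ 4) (u : B₁) :
    IsMorinSingularity (m.op hf) k u ↔
      (∀ i, 1 ≤ i → i ≤ k → Sig f i (m.ι u) = 0) ∧ Sig f (k + 1) (m.ι u) ≠ 0 ∧
        Function.Surjective
          (fderiv ℝ (fun (v : B₁) (i : Fin (k - 1)) => Sig f (i + 1) (m.ι v)) u) := by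
  by_cases hu : Sig f 1 (m.ι u) = 0
  · exact m.isMorinSingularity_iff_of_Sig_one_eq_zero hf hk hu
  · exact iff_of_false (m.not_isMorinSingularity hf hu) fun h => hu (h.1 1 le_rfl hk1)

end Operator

end DerivPair

/-! ### The pairs `(C¹, C⁰)` and `(H¹, L²)` -/

/-- The isomorphism `u ↦ u' + ū` from `C¹` to `C⁰`. -/
def equivC : C1 ≃L[ℝ] C0 :=
  .equivOfInverse
    ((ContinuousLinearMap.snd ℝ C0 C0 + (mean.comp (.fst ℝ C0 C0)).smulRight 1).comp C1.subtypeL)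
    (((primitive + mean.smulRight 1).prod center).codRestrict C1 center_mem_C1)
    (fun ⟨⟨u, x⟩, h⟩ => by
      refine Subtype.ext (Prod.ext ?_ ?_)
      · change primitive (x + mean u • 1) + mean (x + mean u • 1) • 1 = u
        simp [primitive_of_mem_C1 h, mean_of_mem_C1 h]
      · change center (x + mean u • 1) = x
        simp [center_apply, mean_of_mem_C1 h])
    fun x => by
      change center x + mean (primitive x + mean x • 1) • 1 = x
      simp [center_apply, mean_primitive]

/-- The isomorphism `u ↦ u' + ū` from `H¹` to `L²`. -/
def equivH : H1 ≃L[ℝ] L2 :=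
  .equivOfInverse
    ((ContinuousLinearMap.snd ℝ C0 L2 +
      (mean.comp (.fst ℝ C0 L2)).smulRight (toL2 1)).comp H1.subtypeL)
    (((primitiveL2 + meanL2.smulRight 1).prod
      (ContinuousLinearMap.id ℝ L2 - meanL2.smulRight (toL2 1))).codRestrict H1 sub_meanL2_mem_H1)
    (fun ⟨⟨u, v⟩, h⟩ => by
      have hone : primitiveL2 (toL2 1) = 0 := primitive_one
      refine Subtype.ext (Prod.ext ?_ ?_)
      · change primitiveL2 (v + mean u • toL2 1) + meanL2 (v + mean u • toL2 1) • 1 = u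
        simp [primitiveL2_of_mem_H1 h, meanL2_of_mem_H1 h, meanL2_toL2, hone]
      · change v + mean u • toL2 1 - meanL2 (v + mean u • toL2 1) • toL2 1 = v
        simp [meanL2_of_mem_H1 h, meanL2_toL2])
    fun v => by
      change v - meanL2 v • toL2 1 + mean (primitiveL2 v + meanL2 v • 1) • toL2 1 = v
      simp [mean_primitiveL2]

/-- The pair `(C¹, C⁰)`. -/
def pairC : DerivPair C1 C0 where
  ι := (ContinuousLinearMap.fst ℝ C0 C0).comp C1.subtypeL
  d := (ContinuousLinearMap.snd ℝ C0 C0).comp C1.subtypeL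
  e := .id ℝ C0
  avg := mean
  equiv := equivC
  avg_e := fun _ => rfl
  avg_d := fun u => mean_of_mem_C1 u.2
  equiv_apply := fun _ => rfl
  ι_equiv_symm_e := fun _ => rfl

/-- The pair `(H¹, L²)`. -/
def pairH : DerivPair H1 L2 where
  ι := (ContinuousLinearMap.fst ℝ C0 L2).comp H1.subtypeL
  d := (ContinuousLinearMap.snd ℝ C0 L2).comp H1.subtypeL
  e := toL2
  avg := meanL2
  equiv := equivH
  avg_e := meanL2_toL2
  avg_d := fun u => meanL2_of_mem_H1 u.2
  equiv_apply := fun _ => rfl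
  ι_equiv_symm_e := fun _ => rfl

instance : CompleteSpace C1 := pairC.completeSpace

instance : CompleteSpace H1 := pairH.completeSpace

theorem stratumC_eq {f : UnitAddCircle → ℝ → ℝ} (hf : IsSmooth f) (k : ℕ) : stratumC f hf k =
    stratum (pairC.op hf) (fun u => mean (pairC.ι u)) pairC.avg (pairC.e 1) k := by
  simp only [stratumC, ← mean_eq_integral]
  rfl

theorem stratumH_eq {f : UnitAddCircle → ℝ → ℝ} (hf : IsSmooth f) (k : ℕ) : stratumH f hf k =
    stratum (pairH.op hf) (fun u => mean (pairH.ι u)) pairH.avg (pairH.e 1) k := by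
  simp only [stratumH, ← mean_eq_integral, ← meanL2_eq_integral]
  rfl

end CircleODE

end

theorem proposition2p2 (f : UnitAddCircle → ℝ → ℝ) (hf : CircleODE.IsSmooth f) :
    -- the case `F : C¹ → C⁰`
    ((∀ k : ℕ, 1 ≤ k → k ≤ 5 →
        CircleODE.stratumC f hf k =
          {u : CircleODE.C1 | ∀ i, 1 ≤ i → i ≤ k → CircleODE.Sig f i u.1.1 = 0}) ∧
      (∀ k : ℕ, 1 ≤ k → k ≤ 4 → ∀ u : CircleODE.C1,
        CircleODE.IsMorinSingularity (CircleODE.opC f hf) k u ↔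
          (∀ i, 1 ≤ i → i ≤ k → CircleODE.Sig f i u.1.1 = 0) ∧
          CircleODE.Sig f (k + 1) u.1.1 ≠ 0 ∧
          Function.Surjective
            (fderiv ℝ (fun (v : CircleODE.C1) (i : Fin (k - 1)) =>
              CircleODE.Sig f (i + 1) v.1.1) u))) ∧
    -- the case `F : H¹ → L²`
    ((∀ k : ℕ, 1 ≤ k → k ≤ 5 →
        CircleODE.stratumH f hf k =
          {u : CircleODE.H1 | ∀ i, 1 ≤ i → i ≤ k → CircleODE.Sig f i u.1.1 = 0}) ∧
      (∀ k : ℕ, 1 ≤ k → k ≤ 4 → ∀ u : CircleODE.H1,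
        CircleODE.IsMorinSingularity (CircleODE.opH f hf) k u ↔
          (∀ i, 1 ≤ i → i ≤ k → CircleODE.Sig f i u.1.1 = 0) ∧
          CircleODE.Sig f (k + 1) u.1.1 ≠ 0 ∧
          Function.Surjective
            (fderiv ℝ (fun (v : CircleODE.H1) (i : Fin (k - 1)) =>
              CircleODE.Sig f (i + 1) v.1.1) u))) :=
  ⟨⟨fun k _ hk => (CircleODE.stratumC_eq hf k).trans (CircleODE.pairC.stratum_eq hf hk),
    fun _ hk1 hk => CircleODE.pairC.isMorinSingularity_iff hf hk1 hk⟩,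
   ⟨fun k _ hk => (CircleODE.stratumH_eq hf k).trans (CircleODE.pairH.stratum_eq hf hk),
    fun _ hk1 hk => CircleODE.pairH.isMorinSingularity_iff hf hk1 hk⟩⟩
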